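/- **Setting.** Let $G=(V,E)$ be a connected undirected graph with vertex set $V=\{1,\dots,m\}$ and diameter $d$, known to all players. Player $j\in V$ holds a vector $X_j\in\{0,1,\dots,M\}^n$, where $n,M\ge 1$; put $\mathcal X=\sum_{j=1}^m X_j$ and, for $p>0$, $F_p=\sum_{i=1}^n \mathcal X_i^{\,p}$. In a public-coin message passing protocol on $G$ all players see a common infinite string of independent fair random bits. The protocol proceeds in rounds; in each round some of the players each send one bit string across one of their edges, which only the neighbour at the other end receives. Who sends to whom in which round is fixed in advance; the content of a message depends only on the random string, on the sender's own input and on the messages it received in earlier rounds. At the end a distinguished player, fixed in advance, outputs a real number depending on the random string, its input and the messages it received. The total communication is the number of bits in all messages sent, and the max-communication is the maximum, over the edges of $G$, of the number of bits sent across that edge (in both directions) during the execution. The protocol is one-shot if every player other than the distinguished one sends exactly one message, the distinguished player sends none, each player receives messages in at most one round, and a player that receives messages in a round and itself sends a message does so in the next round. **Theorem.** Let $p\in(0,1)$. There is a constant $K>0$, depending only on $p$, such that for all integers $n,m,M\ge 1$, all $\epsilon\in(0,1)$ and every connected graph $G$ on $m$ vertices with diameter $d$ there is a one-shot public-coin message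 passing protocol on $G$ with at most $d$ rounds such that, for all inputs $X_1,\dots,X_m\in\{0,\dots,M\}^n$, 1. with probability at least $2/3$ the output $R$ satisfies $|R-F_p|\le \epsilon F_p$; 2. the max-communication is always at most $\dfrac{K}{\epsilon^2}\left(\log_2\log_2(nmM)+\log_2\dfrac{2}{\epsilon}\right)$ bits; 3. the total communication is always at most $\dfrac{Km}{\epsilon^2}\left(\log_2\log_2(nmM)+\log_2\dfrac{2}{\epsilon}\right)$ bits. Here $\log_2\log_2(nmM)$ is read as $0$ if $nmM=1$. In particular, if $m,M=O(n^c)$ for a constant $c$ and $n\ge2$, $\epsilon\le 1/2$, the max-communication is $O(\epsilon^{-2}(\log\log n+\log(1/\epsilon)))$ bits and the total communication is $O(m\epsilon^{-2}(\log\log n+\log(1/\epsilon)))$ bits, with no dependence on the topology $G$. -/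

import Mathlib

open MeasureTheory

noncomputable section

namespace MessagePassing

/-- The public random string: an infinite sequence of bits, readable by all players. -/
abbrev Coins : Type := ℕ → Bool

/-- The law of the public random string: independent fair bits. -/
def fairCoins : Measure Coins :=
  Measure.infinitePi (fun _ : ℕ => (PMF.uniformOfFintype Bool).toMeasure)

/-- The input of one player: a vector in `{0, 1, …, M}ⁿ`. -/
abbrev Input (n M : ℕ) : Type := Fin n → Fin (M + 1)

/-- What a player has received so far: one entry per past round, in chronological order. An entry
gives, for every potential sender, the message that arrived from it in that round, if any. -/
abbrev Inbox (m : ℕ) : Type := List (Fin m → Option (List Bool))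

/-- A public-coin message passing protocol on the topology `G`, for `m` players (the vertices of
`G`) holding vectors in `{0, …, M}ⁿ`. In each round every player sends at most one message, across
one of its edges. Who speaks to whom in which round is fixed in advance, so that silence and the
choice of the recipient carry no information. The content of a message (a bit string) is a function
of the public coins, of the sender's own input and of the messages it received in earlier rounds. -/
structure Protocol {m : ℕ} (G : SimpleGraph (Fin m)) (n M : ℕ) where
  /-- number of rounds -/
  rounds : ℕ
  /-- the distinguished player who holds the estimate at the end -/
  center : Fin m
  /-- `schedule r v = some w`: in round `r` (counted from 0) player `v` sends a message to `w` -/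
  schedule : ℕ → Fin m → Option (Fin m)
  /-- messages travel along edges only -/
  adj_of_schedule : ∀ r v w, schedule r v = some w → G.Adj v w
  /-- the message that `v` sends in round `r` (used only if `v` is scheduled to speak) -/
  message : ℕ → Fin m → Coins → Input n M → Inbox m → List Bool
  /-- the output of the distinguished player -/
  output : Coins → Input n M → Inbox m → ℝ
  measurable_message : ∀ r v x h s, MeasurableSet {ω : Coins | message r v ω x h = s}
  measurable_output : ∀ x h, Measurable (fun ω : Coins => output ω x h)

namespace Protocol

variable {m n M : ℕ} {G : SimpleGraph (Fin m)} (P : Protocol G n M)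

/-- The inbox of each player just before round `r`, on inputs `X` and coins `ω`. -/
def inbox (X : Fin m → Input n M) (ω : Coins) : ℕ → Fin m → Inbox m
  | 0, _ => []
  | r + 1, v => inbox X ω r v ++
      [fun u => if P.schedule r u = some v then some (P.message r u ω (X u) (inbox X ω r u))
        else none]

/-- The value that the distinguished player holds when the protocol ends. -/
def result (X : Fin m → Input n M) (ω : Coins) : ℝ :=
  P.output ω (X P.center) (P.inbox X ω P.rounds P.center)

/-- Number of bits sent from `u` to `v` in round `r`. -/
def bits (X : Fin m → Input n M) (ω : Coins) (r : ℕ) (u v : Fin m) : ℕ :=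
  if P.schedule r u = some v then (P.message r u ω (X u) (P.inbox X ω r u)).length else 0

/-- Total number of bits sent in all the messages of one execution. -/
def totalCommunication (X : Fin m → Input n M) (ω : Coins) : ℕ :=
  ∑ r ∈ Finset.range P.rounds, ∑ u, ∑ v, P.bits X ω r u v

/-- Number of bits sent across the edge `{u, v}`, in both directions, during one execution. -/
def edgeCommunication (X : Fin m → Input n M) (ω : Coins) (u v : Fin m) : ℕ :=
  ∑ r ∈ Finset.range P.rounds, (P.bits X ω r u v + P.bits X ω r v u)

/-- Maximum number of bits sent across any edge during one execution (non-edges contribute `0`). -/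
def maxCommunication (X : Fin m → Input n M) (ω : Coins) : ℕ :=
  Finset.univ.sup fun e : Fin m × Fin m => P.edgeCommunication X ω e.1 e.2

/-- One-shot protocols: every player except the distinguished one sends exactly one message, the
distinguished player sends none, each player receives messages in at most one round, and a player
who receives messages in some round and speaks does so in the next round. -/
def IsOneShot : Prop :=
  (∀ v, v ≠ P.center → ∃! r, r < P.rounds ∧ (P.schedule r v).isSome) ∧
  (∀ r < P.rounds, P.schedule r P.center = none) ∧
  (∀ r < P.rounds, ∀ s < P.rounds, ∀ u w v,
    P.schedule r u = some v → P.schedule s w = some v → r = s) ∧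
  (∀ r < P.rounds, ∀ s < P.rounds, ∀ u v,
    P.schedule r u = some v → (P.schedule s v).isSome → s = r + 1)

end Protocol

/-- The frequency moment `F_p = ∑ i, 𝒳_i ^ p` of the aggregate vector `𝒳 = ∑ j, X_j`. -/
def frequencyMoment (p : ℝ) {m n M : ℕ} (X : Fin m → Input n M) : ℝ :=
  ∑ i : Fin n, ((∑ j : Fin m, (X j i : ℕ) : ℕ) : ℝ) ^ p

end MessagePassing

end

noncomputable section

namespace MessagePassing

/-! ### Uniform random variables from fair coins -/

/-- The law of one fair bit. -/
abbrev fairBit : Measure Bool := (PMF.uniformOfFintype Bool).toMeasure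

/-- The uniform distribution on `[0, 1)`. -/
def unif : Measure ℝ := volume.restrict (Set.Ico 0 1)

instance : IsProbabilityMeasure unif := ⟨by simp [unif]⟩

open Classical in
lemma fairBit_apply (t : Set Bool) :
    fairBit t = (if false ∈ t then 2⁻¹ else 0) + (if true ∈ t then 2⁻¹ else 0) := by
  rw [fairBit, PMF.toMeasure_apply_fintype]
  simp [Set.indicator_apply, add_comm]

/-- The `i`-th binary digit of a real number. -/
def binDigit (x : ℝ) (i : ℕ) : Bool := decide (⌊x * 2 ^ (i + 1)⌋₊ % 2 = 1)

lemma measurable_binDigit : Measurable binDigit := by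
  refine measurable_pi_lambda _ fun i => ?_
  have h1 : Measurable fun x : ℝ => ⌊x * 2 ^ (i + 1)⌋₊ :=
    Nat.measurable_floor.comp (measurable_id.mul_const _)
  exact (measurable_of_countable (fun k : ℕ => decide (k % 2 = 1))).comp h1

lemma binDigit_zero_of_lt {x : ℝ} (h1 : x < 1 / 2) : binDigit x 0 = false := by
  have : ⌊x * 2 ^ (0 + 1)⌋₊ = 0 := Nat.floor_eq_zero.2 (by norm_num; linarith)
  simp only [binDigit, this]; simp

lemma binDigit_zero_of_le {x : ℝ} (h0 : 1 / 2 ≤ x) (h1 : x < 1) : binDigit x 0 = true := by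
  have : ⌊x * 2 ^ (0 + 1)⌋₊ = 1 := by
    rw [Nat.floor_eq_iff (by norm_num; linarith)]; norm_num; constructor <;> linarith
  simp only [binDigit, this]; simp

lemma binDigit_succ (x : ℝ) (i : ℕ) : binDigit x (i + 1) = binDigit (2 * x) i := by
  simp only [binDigit]
  congr 4
  ring_nf

lemma binDigit_succ_of_le {x : ℝ} (hx : 1 / 2 ≤ x) (i : ℕ) :
    binDigit x (i + 1) = binDigit (2 * x - 1) i := by
  simp only [binDigit]
  have h : (2 * x - 1) * 2 ^ (i + 1) = x * 2 ^ (i + 1 + 1) - ((2 ^ (i + 1) : ℕ) : ℝ) := by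
    push_cast; ring
  rw [h, Nat.floor_sub_natCast]
  have hle : 2 ^ (i + 1) ≤ ⌊x * 2 ^ (i + 1 + 1)⌋₊ := by
    refine Nat.le_floor ?_
    push_cast
    rw [pow_succ (2 : ℝ) (i + 1)]
    nlinarith [pow_pos (zero_lt_two : (0 : ℝ) < 2) (i + 1)]
  have : (2 ^ (i + 1) : ℕ) % 2 = 0 := by simp [pow_succ]
  congr 1
  apply propext
  omega

lemma ofDigits_binDigit {x : ℝ} (hx : x ∈ Set.Ico (0 : ℝ) 1) :
    Real.ofDigits (fun i => if binDigit x i then (1 : Fin 2) else 0) = x := by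
  conv_rhs => rw [← Real.ofDigits_digits (b := 2) (by norm_num) hx]
  congr 1
  ext i
  simp only [binDigit, Real.digits, Fin.ofNat]
  rcases Nat.mod_two_eq_zero_or_one ⌊x * 2 ^ (i + 1)⌋₊ with h | h <;> simp [h]

lemma volume_binDigit (N : ℕ) (t : ℕ → Set Bool) :
    volume {x : ℝ | x ∈ Set.Ico (0 : ℝ) 1 ∧ ∀ i < N, binDigit x i ∈ t i} =
      ∏ i ∈ Finset.range N, fairBit (t i) := by
  classical
  induction N generalizing t with
  | zero =>
    have : {x : ℝ | x ∈ Set.Ico (0 : ℝ) 1 ∧ ∀ i < 0, binDigit x i ∈ t i} = Set.Ico 0 1 := by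
      ext; simp
    rw [this]
    simp
  | succ N ih =>
    set A : Set ℝ := {x : ℝ | x ∈ Set.Ico (0 : ℝ) 1 ∧ ∀ i < N, binDigit x i ∈ t (i + 1)} with hA
    have hm : MeasurableSet {x : ℝ | x < 1 / 2} := measurableSet_Iio
    have e1 : {x : ℝ | x ∈ Set.Ico (0 : ℝ) 1 ∧ ∀ i < N + 1, binDigit x i ∈ t i}
        ∩ {x : ℝ | x < 1 / 2} = if false ∈ t 0 then (fun x => 2 * x) ⁻¹' A else ∅ := by
      ext x
      by_cases hf : false ∈ t 0
      · simp only [hf, if_true, Set.mem_inter_iff, Set.mem_ofPred_eq, Set.mem_preimage, hA,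
          Set.mem_Ico, Nat.forall_lt_succ_left, ← binDigit_succ]
        constructor
        · rintro ⟨⟨⟨h0, h1⟩, h2, h3⟩, h4⟩
          exact ⟨⟨by linarith, by linarith⟩, h3⟩
        · rintro ⟨⟨h0, h1⟩, h3⟩
          have : x < 1 / 2 := by linarith
          exact ⟨⟨⟨by linarith, by linarith⟩, by rwa [binDigit_zero_of_lt this], h3⟩, this⟩
      · simp only [hf, if_false, Set.mem_inter_iff, Set.mem_ofPred_eq, Set.mem_empty_iff_false,
          iff_false, Nat.forall_lt_succ_left]
        rintro ⟨⟨_, h2, _⟩, h4⟩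
        rw [binDigit_zero_of_lt h4] at h2
        exact hf h2
    have e2 : {x : ℝ | x ∈ Set.Ico (0 : ℝ) 1 ∧ ∀ i < N + 1, binDigit x i ∈ t i}
        \ {x : ℝ | x < 1 / 2} =
          if true ∈ t 0 then (fun x => 2 * x) ⁻¹' ((fun x => x + (-1)) ⁻¹' A) else ∅ := by
      ext x
      by_cases hf : true ∈ t 0
      · simp only [hf, if_true, Set.mem_sdiff, Set.mem_ofPred_eq, Set.mem_preimage, hA, not_lt,
          Set.mem_Ico, Nat.forall_lt_succ_left, ← sub_eq_add_neg]
        constructor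
        · rintro ⟨⟨⟨h0, h1⟩, h2, h3⟩, h4⟩
          exact ⟨⟨by linarith, by linarith⟩, fun i hi => binDigit_succ_of_le h4 i ▸ h3 i hi⟩
        · rintro ⟨⟨h0, h1⟩, h3⟩
          have h : 1 / 2 ≤ x := by linarith
          have h' : x < 1 := by linarith
          exact ⟨⟨⟨by linarith, by linarith⟩, by rwa [binDigit_zero_of_le h h'],
            fun i hi => (binDigit_succ_of_le h i).symm ▸ h3 i hi⟩, h⟩
      · simp only [hf, if_false, Set.mem_sdiff, Set.mem_ofPred_eq, Set.mem_empty_iff_false,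
          iff_false, Nat.forall_lt_succ_left, not_lt]
        rintro ⟨⟨h1, h2, _⟩, h4⟩
        rw [binDigit_zero_of_le h4 h1.2] at h2
        exact hf h2
    rw [← measure_inter_add_sdiff _ hm, e1, e2, Finset.prod_range_succ', ← ih (fun i => t (i + 1)), ← hA,
      fairBit_apply]
    have v1 : volume ((fun x : ℝ => 2 * x) ⁻¹' A) = 2⁻¹ * volume A := by
      rw [Real.volume_preimage_mul_left (by norm_num)]
      congr 1
      rw [abs_of_pos (by norm_num), ENNReal.ofReal_inv_of_pos (by norm_num)]; norm_num
    have v2 : volume ((fun x : ℝ => 2 * x) ⁻¹' ((fun x => x + (-1)) ⁻¹' A)) = 2⁻¹ * volume A := by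
      rw [Real.volume_preimage_mul_left (by norm_num), measure_preimage_add_right]
      congr 1
      rw [abs_of_pos (by norm_num), ENNReal.ofReal_inv_of_pos (by norm_num)]; norm_num
    split_ifs <;> simp [v1, v2] <;> ring

lemma map_binDigit_unif : unif.map binDigit = fairCoins := by
  refine Measure.eq_infinitePi _ fun s t ht => ?_
  have hm : MeasurableSet (Set.pi (s : Set ℕ) t) :=
    MeasurableSet.pi s.countable_toSet fun i _ => ht i
  rw [Measure.map_apply measurable_binDigit hm, unif,
    Measure.restrict_apply (measurable_binDigit hm)]
  obtain ⟨N, hN⟩ := s.exists_nat_subset_range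
  have h := volume_binDigit N (fun i => if i ∈ s then t i else Set.univ)
  convert h using 1
  · congr 1
    ext x
    simp only [Set.mem_inter_iff, Set.mem_preimage, Set.mem_pi, Set.mem_ofPred_eq, SetLike.mem_coe]
    rw [and_comm]
    refine and_congr_right fun _ => ⟨fun h i _ => ?_, fun h i hi => ?_⟩
    · split_ifs with his
      · exact h i his
      · trivial
    · simpa [hi] using h i (Finset.mem_range.1 (hN hi))
  · rw [← Finset.prod_subset hN]
    · exact Finset.prod_congr rfl fun i hi => by simp [hi]
    · intro i _ hi
      rw [if_neg hi, measure_univ]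

/-- The real number in `[0, 1]` with the given binary digits. -/
def coinsToReal (ω : Coins) : ℝ := Real.ofDigits (fun i => if ω i then (1 : Fin 2) else 0)

lemma measurable_coinsToReal : Measurable coinsToReal := by
  refine Real.continuous_ofDigits.measurable.comp (measurable_pi_lambda _ fun i => ?_)
  exact (measurable_of_countable (fun b : Bool => if b then (1 : Fin 2) else 0)).comp
    (measurable_pi_apply i)

lemma map_coinsToReal : fairCoins.map coinsToReal = unif := by
  rw [← map_binDigit_unif, Measure.map_map measurable_coinsToReal measurable_binDigit]
  conv_rhs => rw [← Measure.map_id (μ := unif)]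
  refine Measure.map_congr ?_
  filter_upwards [ae_restrict_mem measurableSet_Ico] with x hx
  exact ofDigits_binDigit hx

instance : IsProbabilityMeasure fairCoins := by unfold fairCoins; infer_instance

/-- Finitely many independent copies of a random variable that is a function of the coins are
functions of the coins. -/
lemma exists_iid (ι : Type*) [Fintype ι] [Nonempty ι] {Ω : Type*} [MeasurableSpace Ω]
    {f₀ : Coins → Ω} (hf₀ : Measurable f₀) :
    ∃ f : Coins → ι → Ω, Measurable f ∧
      fairCoins.map f = Measure.pi (fun _ => fairCoins.map f₀) := by
  classical
  obtain ⟨e⟩ : Nonempty (ι × ℕ ≃ ℕ) := nonempty_equiv_of_countable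
  let g : Coins → ι → Coins := fun ω a b => ω (e (a, b))
  have hg : Measurable g := by
    refine measurable_pi_lambda _ fun a => measurable_pi_lambda _ fun b => measurable_pi_apply _
  have hgm : fairCoins.map g = Measure.infinitePi (fun _ : ι => fairCoins) := by
    have h1 := Measure.infinitePi_map_piCongrLeft (fun _ : ι × ℕ => fairBit) e.symm
    have h2 := Measure.infinitePi_map_curry (fun (_ : ι) (_ : ℕ) => fairBit)
    have : fairCoins = Measure.infinitePi (fun _ : ℕ => fairBit) := rfl
    rw [this, ← h2, ← h1,
      Measure.map_map (MeasurableEquiv.measurable _) (MeasurableEquiv.measurable _)]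
    congr 1
    ext ω a b
    simp [g, MeasurableEquiv.piCongrLeft, Equiv.piCongrLeft, MeasurableEquiv.curry]
  have hf : Measurable fun (y : ι → Coins) i => f₀ (y i) :=
    measurable_pi_lambda _ fun i => hf₀.comp (measurable_pi_apply i)
  refine ⟨fun ω i => f₀ (g ω i), hf.comp hg, ?_⟩
  have h3 := Measure.infinitePi_map_pi (fun _ : ι => fairCoins) (f := fun _ => f₀) (fun _ => hf₀)
  rw [← hgm, Measure.map_map hf hg] at h3
  have : IsProbabilityMeasure (fairCoins.map f₀) := Measure.isProbabilityMeasure_map hf₀.aemeasurable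
  rw [← Measure.infinitePi_eq_pi, ← h3]
  rfl

/-- Independent copies of two independent families of uniform random variables are functions of the
coins. -/
lemma exists_uniforms (k ι κ : Type*) [Fintype k] [Nonempty k] [Fintype ι] [Fintype κ]
    [Nonempty κ] :
    ∃ f : Coins → k → (ι → ℝ) × (κ → ℝ), Measurable f ∧
      fairCoins.map f = Measure.pi (fun _ =>
        (Measure.pi fun _ : ι => unif).prod (Measure.pi fun _ : κ => unif)) := by
  obtain ⟨f₁, hf₁, hm₁⟩ := exists_iid (ι ⊕ κ) measurable_coinsToReal
  rw [map_coinsToReal] at hm₁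
  have h := measurePreserving_sumPiEquivProdPi (fun _ : ι ⊕ κ => unif)
  obtain ⟨f, hf, hm⟩ := exists_iid k (h.measurable.comp hf₁)
  refine ⟨f, hf, ?_⟩
  rw [hm, ← Measure.map_map h.measurable hf₁, hm₁, h.map_eq]

/-! ### Randomized rounding to a geometric grid -/

/-- The geometric grid `0, τ, τ (1 + γ), τ (1 + γ)², …`. -/
def grid (τ γ : ℝ) : ℕ → ℝ
  | 0 => 0
  | i + 1 => τ * (1 + γ) ^ i

lemma grid_zero (τ γ : ℝ) : grid τ γ 0 = 0 := rfl

lemma grid_succ (τ γ : ℝ) (i : ℕ) : grid τ γ (i + 1) = τ * (1 + γ) ^ i := rfl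

lemma grid_strictMono {τ γ : ℝ} (hτ : 0 < τ) (hγ : 0 < γ) : StrictMono (grid τ γ) := by
  refine strictMono_nat_of_lt_succ fun i => ?_
  cases i with
  | zero => simpa [grid] using hτ
  | succ i =>
    rw [grid_succ, grid_succ, pow_succ]
    have : 0 < τ * (1 + γ) ^ i := by positivity
    nlinarith

lemma grid_nonneg {τ γ : ℝ} (hτ : 0 < τ) (hγ : 0 < γ) (i : ℕ) : 0 ≤ grid τ γ i :=
  (grid_strictMono hτ hγ).monotone (Nat.zero_le i)

/-- Randomized rounding of `S` to the grid `g 0 < ⋯ < g L`: the index of the grid point chosen with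
the help of the uniform random number `u`. -/
def roundIdx (g : ℕ → ℝ) (L : ℕ) (S u : ℝ) : ℕ :=
  ∑ i ∈ Finset.range L, if g i + |u| * (g (i + 1) - g i) < S then 1 else 0

lemma roundIdx_le (g : ℕ → ℝ) (L : ℕ) (S u : ℝ) : roundIdx g L S u ≤ L := by
  calc roundIdx g L S u ≤ ∑ i ∈ Finset.range L, 1 :=
        Finset.sum_le_sum fun i _ => by split_ifs <;> simp
    _ = L := by simp

lemma measurable_roundIdx (g : ℕ → ℝ) (L : ℕ) :
    Measurable fun p : ℝ × ℝ => roundIdx g L p.1 p.2 := by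
  refine Finset.measurable_sum _ fun i _ => ?_
  refine Measurable.ite (measurableSet_lt ?_ measurable_fst) measurable_const measurable_const
  exact measurable_const.add (measurable_snd.abs.mul_const _)

lemma roundIdx_zero {g : ℕ → ℝ} (hg : Monotone g) (h0 : g 0 = 0) (L : ℕ) (u : ℝ) :
    roundIdx g L 0 u = 0 := by
  refine Finset.sum_eq_zero fun i _ => if_neg (not_lt.2 ?_)
  have h1 : 0 ≤ g i := h0 ▸ hg (Nat.zero_le i)
  exact add_nonneg h1 (mul_nonneg (abs_nonneg u) (sub_nonneg.2 (hg (Nat.le_succ i))))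

section

variable {g : ℕ → ℝ} {L : ℕ} {S u : ℝ}

lemma roundIdx_eq_of_mem (hg : StrictMono g) (hu : u ∈ Set.Ico (0 : ℝ) 1) {j : ℕ} (hj : j < L)
    (h0 : g j ≤ S) (h1 : S < g (j + 1)) :
    roundIdx g L S u = j + if u * (g (j + 1) - g j) < S - g j then 1 else 0 := by
  obtain ⟨hu0, hu1⟩ := hu
  have e : ∀ i ∈ Finset.range L, (if g i + u * (g (i + 1) - g i) < S then 1 else 0) =
      (if i < j then 1 else 0) +
        if i = j then (if u * (g (j + 1) - g j) < S - g j then 1 else 0) else 0 := by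
    intro i _
    have hd : 0 < g (i + 1) - g i := sub_pos.2 (hg (Nat.lt_succ_self i))
    rcases lt_trichotomy i j with h | h | h
    · have : g (i + 1) ≤ g j := hg.monotone h
      rw [if_pos (by nlinarith), if_pos h, if_neg h.ne]
    · subst h
      simp [lt_sub_iff_add_lt']
    · have : g (j + 1) ≤ g i := hg.monotone h
      rw [if_neg (by nlinarith [mul_nonneg hu0 hd.le]), if_neg h.not_gt, if_neg h.ne']
  rw [roundIdx, abs_of_nonneg hu0, Finset.sum_congr rfl e, Finset.sum_add_distrib, Finset.sum_ite_eq',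
    if_pos (Finset.mem_range.2 hj), Finset.sum_ite, Finset.sum_const_zero, add_zero]
  congr 1
  have : (Finset.range L).filter (fun i => i < j) = Finset.range j := by
    ext i; simp; omega
  simp [this]

lemma roundIdx_eq_of_le (hg : StrictMono g) (hu : u ∈ Set.Ico (0 : ℝ) 1) (h0 : g L ≤ S) :
    roundIdx g L S u = L := by
  obtain ⟨hu0, hu1⟩ := hu
  have e : ∀ i ∈ Finset.range L, (if g i + u * (g (i + 1) - g i) < S then 1 else 0) = 1 := by
    intro i hi
    have hd : 0 < g (i + 1) - g i := sub_pos.2 (hg (Nat.lt_succ_self i))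
    have : g (i + 1) ≤ g L := hg.monotone (Finset.mem_range.1 hi)
    rw [if_pos (by nlinarith)]
  rw [roundIdx, abs_of_nonneg hu0, Finset.sum_congr rfl e]
  simp

lemma unif_real_Iio {θ : ℝ} (h0 : 0 ≤ θ) (h1 : θ ≤ 1) : unif.real (Set.Iio θ) = θ := by
  rw [unif, measureReal_restrict_apply measurableSet_Iio]
  have : Set.Iio θ ∩ Set.Ico 0 1 = Set.Ico 0 θ := by
    ext x; simp only [Set.mem_inter_iff, Set.mem_Iio, Set.mem_Ico]
    constructor
    · rintro ⟨a, b, c⟩; exact ⟨b, a⟩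
    · rintro ⟨a, b⟩; exact ⟨b, a, by linarith⟩
  simp [this, h0]

lemma ae_unif : ∀ᵐ u ∂unif, u ∈ Set.Ico (0 : ℝ) 1 := ae_restrict_mem measurableSet_Ico

lemma integral_roundIdx_of_mem (hg : StrictMono g) {j : ℕ} (hj : j < L)
    (h0 : g j ≤ S) (h1 : S < g (j + 1)) (f : ℕ → ℝ) :
    ∫ u, f (roundIdx g L S u) ∂unif =
      f j + (S - g j) / (g (j + 1) - g j) * (f (j + 1) - f j) := by
  have hd : 0 < g (j + 1) - g j := by linarith
  have e : ∀ᵐ u ∂unif, f (roundIdx g L S u) =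
      f j + (Set.Iio ((S - g j) / (g (j + 1) - g j))).indicator (fun _ => f (j + 1) - f j) u := by
    filter_upwards [ae_unif] with u hu
    rw [roundIdx_eq_of_mem hg hu hj h0 h1]
    simp only [Set.indicator, Set.mem_Iio, lt_div_iff₀ hd]
    split_ifs <;> simp
  rw [integral_congr_ae e, integral_add (integrable_const _)
    ((integrable_const _).indicator measurableSet_Iio), integral_indicator_const _ measurableSet_Iio,
    unif_real_Iio (div_nonneg (by linarith) hd.le) ((div_le_one hd).2 (by linarith))]
  simp

lemma integral_roundIdx_of_le (hg : StrictMono g) (h0 : g L ≤ S) (f : ℕ → ℝ) :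
    ∫ u, f (roundIdx g L S u) ∂unif = f L := by
  have e : ∀ᵐ u ∂unif, f (roundIdx g L S u) = f L := by
    filter_upwards [ae_unif] with u hu
    rw [roundIdx_eq_of_le hg hu h0]
  rw [integral_congr_ae e]
  simp

lemma exists_grid_cell (hS : g 0 ≤ S) (h : S < g L) : ∃ j < L, g j ≤ S ∧ S < g (j + 1) := by
  induction L with
  | zero => exact absurd h (not_lt.2 hS)
  | succ L ih =>
    rcases lt_or_ge S (g L) with h' | h'
    · obtain ⟨j, hj, h⟩ := ih h'
      exact ⟨j, hj.trans (Nat.lt_succ_self L), h⟩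
    · exact ⟨L, Nat.lt_succ_self L, h', h⟩

/-- Below the last grid point the rounding is unbiased. -/
lemma integral_round (hg : StrictMono g) (hS : g 0 ≤ S) :
    ∫ u, g (roundIdx g L S u) ∂unif = min S (g L) := by
  rcases lt_or_ge S (g L) with h | h
  · obtain ⟨j, hj, h0, h1⟩ := exists_grid_cell hS h
    have hd : g (j + 1) - g j ≠ 0 := by linarith
    rw [integral_roundIdx_of_mem hg hj h0 h1, min_eq_left h.le, div_mul_cancel₀ _ hd]
    ring
  · rw [integral_roundIdx_of_le hg h, min_eq_right h]

end

lemma sum_sq_le_mul_sum {W : Type*} (s : Finset W) (y : W → ℝ) (hy : ∀ w ∈ s, 0 ≤ y w) {a : ℝ}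
    (ha : ∀ w ∈ s, y w ≤ a) :
    ∑ w ∈ s, y w ^ 2 ≤ a * ∑ w ∈ s, y w := by
  rw [Finset.mul_sum]
  exact Finset.sum_le_sum fun w hw => by nlinarith [hy w hw, ha w hw]

/-- The second moment of the rounded value of a sum of a number `x0` and of grid points. -/
lemma integral_round_sq_le {W : Type*} (s : Finset W) (y : W → ℕ) {τ γ x0 : ℝ} {L : ℕ}
    (hτ : 0 < τ) (hγ : 0 < γ) (hx0 : 0 ≤ x0) {S : ℝ} (hS : S = x0 + ∑ w ∈ s, grid τ γ (y w)) :
    ∫ u, grid τ γ (roundIdx (grid τ γ) L S u) ^ 2 ∂unif ≤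
      (1 + γ) * (S ^ 2 - ∑ w ∈ s, grid τ γ (y w) ^ 2) + ∑ w ∈ s, grid τ γ (y w) ^ 2 + τ * x0 := by
  have hg := grid_strictMono hτ hγ
  have hn := grid_nonneg hτ hγ
  set g := grid τ γ with hgdef
  have hsum0 : 0 ≤ ∑ w ∈ s, g (y w) := Finset.sum_nonneg fun w _ => hn _
  have hle : ∀ w ∈ s, g (y w) ≤ S := fun w hw => by
    have := Finset.single_le_sum (f := fun w => g (y w)) (fun w _ => hn _) hw
    linarith
  have hS0 : 0 ≤ S := by linarith
  have hsq : ∑ w ∈ s, g (y w) ^ 2 ≤ S ^ 2 := by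
    have := sum_sq_le_mul_sum s (fun w => g (y w)) (fun w _ => hn _) hle
    nlinarith
  rcases lt_or_ge S (g L) with h | h
  · obtain ⟨j, hj, h0, h1⟩ := exists_grid_cell (g := g) hS0 h
    have hd : g (j + 1) - g j ≠ 0 := by linarith
    rw [integral_roundIdx_of_mem hg hj h0 h1 (fun i => g i ^ 2)]
    have e : (S - g j) / (g (j + 1) - g j) * (g (j + 1) ^ 2 - g j ^ 2) =
        (S - g j) * (g (j + 1) + g j) := by
      field_simp
      ring
    rw [e]
    have hlej : ∀ w ∈ s, g (y w) ≤ g j := fun w hw => by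
      have : y w < j + 1 := hg.lt_iff_lt.1 ((hle w hw).trans_lt h1)
      exact hg.monotone (Nat.lt_succ_iff.1 this)
    have key := sum_sq_le_mul_sum s (fun w => g (y w)) (fun w _ => hn _) hlej
    suffices (S - g j) * (g (j + 1) - S) ≤ γ * (S ^ 2 - ∑ w ∈ s, g (y w) ^ 2) + τ * x0 by
      nlinarith
    rcases Nat.eq_zero_or_pos j with rfl | hjpos
    · have hz : g 0 = 0 := rfl
      have h1' : g (0 + 1) = τ := by simp [hgdef, grid]
      rw [hz] at hlej ⊢
      rw [h1']
      have : ∑ w ∈ s, g (y w) = 0 :=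
        le_antisymm (Finset.sum_nonpos fun w hw => hlej w hw) hsum0
      have : S = x0 := by linarith
      nlinarith
    · obtain ⟨i, rfl⟩ : ∃ i, j = i + 1 := ⟨j - 1, by omega⟩
      have h2 : g (i + 1 + 1) = (1 + γ) * g (i + 1) := by
        simp only [hgdef, grid_succ, pow_succ]; ring
      set a := g (i + 1) with ha
      have ha0 : 0 ≤ a := hn _
      have h3 : (S - a) * (g (i + 1 + 1) - S) ≤ (S - a) * (γ * a) := by
        rw [h2]; exact mul_le_mul_of_nonneg_left (by nlinarith) (by linarith)
      have h4 : (S - a) * a ≤ S ^ 2 - ∑ w ∈ s, g (y w) ^ 2 := by nlinarith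
      nlinarith [mul_le_mul_of_nonneg_left h4 hγ.le, mul_nonneg hτ.le hx0]
  · rw [integral_roundIdx_of_le hg h (fun i => g i ^ 2)]
    have : g L ^ 2 ≤ S ^ 2 := by nlinarith [hn L]
    nlinarith [mul_nonneg hτ.le hx0]

/-! ### Integrating out one coordinate -/

lemma map_update_pi_unif {V : Type*} [Fintype V] [DecidableEq V] (v : V) :
    ((Measure.pi fun _ : V => unif).prod unif).map
      (fun p : (V → ℝ) × ℝ => Function.update p.1 v p.2) = Measure.pi fun _ : V => unif := by
  have hm : Measurable (fun p : (V → ℝ) × ℝ => Function.update p.1 v p.2) := measurable_update'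
  refine (Measure.pi_eq fun t ht => ?_).symm
  rw [Measure.map_apply hm (MeasurableSet.univ_pi ht)]
  have : (fun p : (V → ℝ) × ℝ => Function.update p.1 v p.2) ⁻¹' Set.pi Set.univ t =
      (Set.pi Set.univ (Function.update t v Set.univ)) ×ˢ t v := by
    ext ⟨b, s⟩
    simp only [Set.mem_preimage, Set.mem_pi, Set.mem_univ, true_implies, Set.mem_prod]
    constructor
    · intro h
      refine ⟨fun i => ?_, by simpa using h v⟩
      by_cases hi : i = v
      · subst hi; simp
      · simpa [hi] using h i
    · rintro ⟨h, h'⟩ i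
      by_cases hi : i = v
      · subst hi; simpa using h'
      · simpa [hi] using h i
  rw [this, Measure.prod_prod, Measure.pi_pi, ← Finset.prod_erase_mul _ _ (Finset.mem_univ v),
    ← Finset.prod_erase_mul (a := v) _ (fun i => unif (t i)) (Finset.mem_univ v)]
  simp only [Function.update_self, measure_univ, mul_one]
  congr 1
  exact Finset.prod_congr rfl fun i hi => by
    rw [Function.update_of_ne (Finset.ne_of_mem_erase hi)]

lemma integral_pi_unif_update {V : Type*} [Fintype V] [DecidableEq V] (v : V)
    {F : (V → ℝ) → ℝ} (hm : Measurable F) (hF : Integrable F (Measure.pi fun _ : V => unif)) :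
    ∫ b, F b ∂(Measure.pi fun _ : V => unif) =
      ∫ b, ∫ s, F (Function.update b v s) ∂unif ∂(Measure.pi fun _ : V => unif) := by
  have hu : Measurable (fun p : (V → ℝ) × ℝ => Function.update p.1 v p.2) := measurable_update'
  have h := map_update_pi_unif v
  conv_lhs => rw [← h]
  rw [integral_map hu.aemeasurable hm.aestronglyMeasurable]
  rw [← h] at hF
  exact integral_prod _ ((integrable_map_measure hm.aestronglyMeasurable hu.aemeasurable).1 hF)

/-- A rooted tree on the vertex set `V`, given by parents and depths. -/
structure RootedTree (V : Type*) where
  root : V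
  parent : V → V
  depth : V → ℕ
  parent_root : parent root = root
  depth_root : depth root = 0
  depth_parent : ∀ v, v ≠ root → depth v = depth (parent v) + 1

namespace RootedTree

variable {V : Type*} [Fintype V] [DecidableEq V] (T : RootedTree V)

/-- The children of a vertex. -/
def children (v : V) : Finset V := Finset.univ.filter fun u => u ≠ T.root ∧ T.parent u = v

lemma mem_children {u v : V} : u ∈ T.children v ↔ u ≠ T.root ∧ T.parent u = v := by
  simp [children]

open Classical in
/-- The vertices of the subtree below a vertex. -/
def subtree (v : V) : Finset V := Finset.univ.filter fun u => ∃ k, T.parent^[k] u = v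

lemma mem_subtree {u v : V} : u ∈ T.subtree v ↔ ∃ k, T.parent^[k] u = v := by
  simp [subtree]

lemma self_mem_subtree (v : V) : v ∈ T.subtree v := T.mem_subtree.2 ⟨0, rfl⟩

lemma depth_of_mem_children {u v : V} (h : u ∈ T.children v) : T.depth u = T.depth v + 1 := by
  obtain ⟨h1, h2⟩ := T.mem_children.1 h
  rw [T.depth_parent u h1, h2]

lemma depth_iterate (k : ℕ) (u : V) : T.depth (T.parent^[k] u) = T.depth u - k := by
  induction k generalizing u with
  | zero => simp
  | succ k ih =>
    rw [Function.iterate_succ_apply, ih]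
    by_cases h : u = T.root
    · subst h; rw [T.parent_root, T.depth_root]; simp
    · rw [T.depth_parent u h]; omega

lemma subtree_root : T.subtree T.root = Finset.univ := by
  ext u
  simp only [Finset.mem_univ, iff_true, mem_subtree]
  refine ⟨T.depth u, ?_⟩
  by_contra h
  have h1 := T.depth_parent _ h
  rw [depth_iterate] at h1
  omega

lemma subtree_eq (v : V) :
    T.subtree v = insert v ((T.children v).biUnion T.subtree) := by
  ext u
  simp only [Finset.mem_insert, Finset.mem_biUnion, mem_subtree]
  constructor
  · rintro ⟨k, hk⟩
    induction k with
    | zero => exact Or.inl hk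
    | succ k ih =>
      by_cases h : T.parent^[k] u = v
      · exact ih h
      · right
        rw [Function.iterate_succ_apply'] at hk
        refine ⟨T.parent^[k] u, T.mem_children.2 ⟨fun hr => h ?_, hk⟩, k, rfl⟩
        rw [hr, T.parent_root] at hk
        rw [hr, hk]
  · rintro (rfl | ⟨w, hw, k, hk⟩)
    · exact ⟨0, rfl⟩
    · refine ⟨k + 1, ?_⟩
      rw [Function.iterate_succ_apply', hk]
      exact (T.mem_children.1 hw).2

lemma subtree_subset {u v : V} (h : u ∈ T.children v) : T.subtree u ⊆ T.subtree v := by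
  rw [T.subtree_eq v]
  exact (Finset.subset_biUnion_of_mem T.subtree h).trans (Finset.subset_insert _ _)

lemma notMem_subtree_of_mem_children {u v : V} (h : u ∈ T.children v) : v ∉ T.subtree u := by
  intro hv
  obtain ⟨k, hk⟩ := T.mem_subtree.1 hv
  have h1 := T.depth_iterate k v
  rw [hk, T.depth_of_mem_children h] at h1
  omega

lemma disjoint_subtree {u w v : V} (hu : u ∈ T.children v) (hw : w ∈ T.children v)
    (h : u ≠ w) : Disjoint (T.subtree u) (T.subtree w) := by
  rw [Finset.disjoint_left]
  intro a ha hb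
  obtain ⟨k, hk⟩ := T.mem_subtree.1 ha
  obtain ⟨l, hl⟩ := T.mem_subtree.1 hb
  have h1 := T.depth_iterate k a
  have h2 := T.depth_iterate l a
  rw [hk, T.depth_of_mem_children hu] at h1
  rw [hl, T.depth_of_mem_children hw] at h2
  have : k = l := by omega
  subst this
  exact h (hk.symm.trans hl)

lemma sum_subtree (f : V → ℝ) (v : V) :
    ∑ u ∈ T.subtree v, f u = f v + ∑ w ∈ T.children v, ∑ u ∈ T.subtree w, f u := by
  rw [T.subtree_eq v, Finset.sum_insert, Finset.sum_biUnion]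
  · exact fun u hu w hw h => T.disjoint_subtree hu hw h
  · simp only [Finset.mem_biUnion, not_exists, not_and]
    exact fun w hw => T.notMem_subtree_of_mem_children hw

/-- Induction from the leaves to the root. -/
lemma induction_children {P : V → Prop} (h : ∀ v, (∀ w ∈ T.children v, P w) → P v) (v : V) :
    P v := by
  obtain ⟨B, hB⟩ : ∃ B, ∀ v, T.depth v ≤ B :=
    ⟨Finset.univ.sup T.depth, fun v => Finset.le_sup (Finset.mem_univ v)⟩
  induction hn : B - T.depth v using Nat.strong_induction_on generalizing v with
  | _ n ih =>
    refine h v fun w hw => ?_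
    have h1 := T.depth_of_mem_children hw
    have h2 := hB w
    exact ih (B - T.depth w) (by omega) w rfl

end RootedTree

/-! ### Summing up a tree with randomized rounding at every vertex -/

/-- `I b v` is the grid index at vertex `v` if every vertex `v` adds its own number `x v` to the grid
points obtained from its children and rounds the sum, using the random number `b v`. -/
def IsTreeRounding {V : Type*} [Fintype V] [DecidableEq V] (T : RootedTree V) (g : ℕ → ℝ) (L : ℕ)
    (x : V → ℝ) (I : (V → ℝ) → V → ℕ) : Prop :=
  ∀ b v, I b v = roundIdx g L (x v + ∑ w ∈ T.children v, g (I b w)) (b v)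

namespace IsTreeRounding

variable {V : Type*} [Fintype V] [DecidableEq V] {T : RootedTree V} {g : ℕ → ℝ} {L : ℕ}
  {x : V → ℝ} {I : (V → ℝ) → V → ℕ}

lemma idx_le (h : IsTreeRounding T g L x I) (b : V → ℝ) (v : V) : I b v ≤ L := by
  rw [h]; exact roundIdx_le _ _ _ _

lemma measurable_idx (h : IsTreeRounding T g L x I) (v : V) : Measurable fun b => I b v := by
  induction v using T.induction_children with
  | h v ih =>
    have e : (fun b => I b v) = (fun p : ℝ × ℝ => roundIdx g L p.1 p.2) ∘
        fun b => (x v + ∑ w ∈ T.children v, g (I b w), b v) := funext fun b => h b v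
    rw [e]
    refine (measurable_roundIdx g L).comp (Measurable.prodMk ?_ (measurable_pi_apply v))
    exact measurable_const.add (Finset.measurable_sum _ fun w hw =>
      (measurable_of_countable g).comp (ih w hw))

lemma idx_update (h : IsTreeRounding T g L x I) {a v : V} (ha : a ∉ T.subtree v) (b : V → ℝ)
    (s : ℝ) : I (Function.update b a s) v = I b v := by
  induction v using T.induction_children with
  | h v ih =>
    have hav : v ≠ a := fun hv => ha (hv ▸ T.self_mem_subtree v)
    rw [h, h, Function.update_of_ne hav]
    congr 2
    exact Finset.sum_congr rfl fun w hw => by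
      rw [ih w hw fun hw' => ha (T.subtree_subset hw hw')]

variable {τ γ : ℝ}

/-- The sum at a vertex does not depend on the vertex's own random number. -/
lemma sum_update (h : IsTreeRounding T g L x I) (v : V) (b : V → ℝ) (s : ℝ) :
    ∑ w ∈ T.children v, g (I (Function.update b v s) w) = ∑ w ∈ T.children v, g (I b w) :=
  Finset.sum_congr rfl fun w hw => by
    rw [h.idx_update (T.notMem_subtree_of_mem_children hw)]

lemma update_self (h : IsTreeRounding T g L x I) (v : V) (b : V → ℝ) (s : ℝ) :
    I (Function.update b v s) v = roundIdx g L (x v + ∑ w ∈ T.children v, g (I b w)) s := by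
  rw [h, h.sum_update, Function.update_self]

local notation "μV" => Measure.pi (fun _ : V => unif)

lemma integrable_comp (h : IsTreeRounding T g L x I) (F : (V → ℕ) → ℝ) :
    Integrable (fun b => F (I b)) μV := by
  refine Integrable.of_bound (C := ∑ i ∈ Fintype.piFinset fun _ => Finset.range (L + 1), |F i|)
    ((measurable_of_countable F).comp
      (measurable_pi_lambda _ h.measurable_idx)).aestronglyMeasurable
    (Filter.Eventually.of_forall fun b => ?_)
  exact Finset.single_le_sum (f := fun i => |F i|) (fun i _ => abs_nonneg _)
    (Fintype.mem_piFinset.2 fun v => Finset.mem_range.2 (Nat.lt_succ_of_le (h.idx_le b v)))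

lemma integral_comp_eq (h : IsTreeRounding T g L x I) (v : V) (F : (V → ℕ) → ℝ) :
    ∫ b, F (I b) ∂μV = ∫ b, ∫ s, F (I (Function.update b v s)) ∂unif ∂μV :=
  integral_pi_unif_update v ((measurable_of_countable F).comp
    (measurable_pi_lambda _ h.measurable_idx)) (h.integrable_comp F)

/-- The rounded value at `u` is at most unbiased, conditionally on all that happens outside the
subtree of `u`. -/
lemma integral_mul_le (h : IsTreeRounding T (grid τ γ) L x I) (hτ : 0 < τ) (hγ : 0 < γ)
    (hx : ∀ v, 0 ≤ x v) (F : (V → ℕ) → ℝ) (hF : ∀ i, 0 ≤ F i) (u : V)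
    (hFu : ∀ a ∈ T.subtree u, ∀ b s, F (I (Function.update b a s)) = F (I b)) :
    ∫ b, grid τ γ (I b u) * F (I b) ∂μV ≤ (∑ a ∈ T.subtree u, x a) * ∫ b, F (I b) ∂μV := by
  have hn := grid_nonneg hτ hγ
  have hg := grid_strictMono hτ hγ
  induction u using T.induction_children with
  | h u ih =>
    have e1 : ∫ b, grid τ γ (I b u) * F (I b) ∂μV =
        ∫ b, min (x u + ∑ w ∈ T.children u, grid τ γ (I b w)) (grid τ γ L) * F (I b) ∂μV := by
      rw [h.integral_comp_eq u (fun i => grid τ γ (i u) * F i)]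
      congr 1
      ext b
      simp only [hFu u (T.self_mem_subtree u), h.update_self]
      rw [integral_mul_const, integral_round hg]
      exact add_nonneg (hx u) (Finset.sum_nonneg fun w _ => hn _)
    have e2 : ∫ b, grid τ γ (I b u) * F (I b) ∂μV ≤
        ∫ b, (x u * F (I b) + ∑ w ∈ T.children u, grid τ γ (I b w) * F (I b)) ∂μV := by
      rw [e1]
      refine integral_mono
        (h.integrable_comp fun i =>
          min (x u + ∑ w ∈ T.children u, grid τ γ (i w)) (grid τ γ L) * F i)
        (h.integrable_comp fun i => x u * F i + ∑ w ∈ T.children u, grid τ γ (i w) * F i)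
        fun b => ?_
      simp only
      rw [← Finset.sum_mul, ← add_mul]
      exact mul_le_mul_of_nonneg_right (min_le_left _ _) (hF _)
    refine e2.trans ?_
    rw [integral_add (h.integrable_comp fun i => x u * F i)
      (h.integrable_comp fun i => ∑ w ∈ T.children u, grid τ γ (i w) * F i),
      integral_finsetSum _ fun w _ => h.integrable_comp fun i => grid τ γ (i w) * F i,
      integral_const_mul, T.sum_subtree, add_mul, Finset.sum_mul]
    gcongr with w hw
    exact ih w hw fun a ha => hFu a (T.subtree_subset hw ha)

lemma integral_le (h : IsTreeRounding T (grid τ γ) L x I) (hτ : 0 < τ) (hγ : 0 < γ)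
    (hx : ∀ v, 0 ≤ x v) (u : V) :
    ∫ b, grid τ γ (I b u) ∂μV ≤ ∑ a ∈ T.subtree u, x a := by
  simpa using h.integral_mul_le hτ hγ hx (fun _ => 1) (fun _ => zero_le_one) u fun _ _ _ _ => rfl

end IsTreeRounding

lemma sq_sum_eq_sum_erase {W : Type*} [DecidableEq W] (s : Finset W) (y : W → ℝ) :
    (∑ w ∈ s, y w) ^ 2 = ∑ w ∈ s, y w ^ 2 + ∑ w ∈ s, ∑ w' ∈ s.erase w, y w * y w' := by
  rw [sq, Finset.sum_mul_sum, ← Finset.sum_add_distrib]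
  exact Finset.sum_congr rfl fun w hw => by
    rw [← Finset.add_sum_erase s _ hw]; ring

namespace IsTreeRounding

variable {V : Type*} [Fintype V] [DecidableEq V] {T : RootedTree V} {g : ℕ → ℝ} {L : ℕ}
  {x : V → ℝ} {I : (V → ℝ) → V → ℕ} {τ γ : ℝ}

local notation "μV" => Measure.pi (fun _ : V => unif)

/-- Second moments of the sum at a vertex and of its rounded value. -/
lemma integral_sq_le (h : IsTreeRounding T (grid τ γ) L x I) (hτ : 0 < τ) (hγ : 0 < γ)
    (hx : ∀ v, 0 ≤ x v) (v : V) :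
    ∫ b, (x v + ∑ w ∈ T.children v, grid τ γ (I b w)) ^ 2 ∂μV ≤
        (1 + γ) * (∑ a ∈ T.subtree v, x a) ^ 2 + τ * ∑ a ∈ T.subtree v, x a ∧
      ∫ b, grid τ γ (I b v) ^ 2 ∂μV ≤
        (1 + γ) * (∑ a ∈ T.subtree v, x a) ^ 2 + τ * ∑ a ∈ T.subtree v, x a := by
  have hn := grid_nonneg hτ hγ
  have hg := grid_strictMono hτ hγ
  induction v using T.induction_children with
  | h v ih =>
    set C := T.children v with hC
    set X : V → ℝ := fun w => ∑ a ∈ T.subtree w, x a with hX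
    have hX0 : ∀ w, 0 ≤ X w := fun w => Finset.sum_nonneg fun a _ => hx a
    let D : (V → ℕ) → ℝ := fun i => x v ^ 2 + 2 * x v * ∑ w ∈ C, grid τ γ (i w) +
      ∑ w ∈ C, ∑ w' ∈ C.erase w, grid τ γ (i w) * grid τ γ (i w')
    have hD : ∀ i : V → ℕ, (x v + ∑ w ∈ C, grid τ γ (i w)) ^ 2 -
        ∑ w ∈ C, grid τ γ (i w) ^ 2 = D i := fun i => by
      have := sq_sum_eq_sum_erase C (fun w => grid τ γ (i w))
      simp only [D]
      linear_combination this
    have hD0 : ∀ i, 0 ≤ D i := fun i =>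
      add_nonneg (add_nonneg (sq_nonneg _) (mul_nonneg (mul_nonneg zero_le_two (hx v))
        (Finset.sum_nonneg fun w _ => hn _)))
        (Finset.sum_nonneg fun w _ => Finset.sum_nonneg fun w' _ => mul_nonneg (hn _) (hn _))
    let Q : (V → ℕ) → ℝ := fun i => (1 + γ) * D i + ∑ w ∈ C, grid τ γ (i w) ^ 2 + τ * x v
    have hQ1 : ∫ b, (x v + ∑ w ∈ C, grid τ γ (I b w)) ^ 2 ∂μV ≤ ∫ b, Q (I b) ∂μV := by
      refine integral_mono (h.integrable_comp fun i => (x v + ∑ w ∈ C, grid τ γ (i w)) ^ 2)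
        (h.integrable_comp Q) fun b => ?_
      have h1 := hD (I b)
      have h2 := mul_nonneg hγ.le (hD0 (I b))
      have h3 := mul_nonneg hτ.le (hx v)
      simp only [Q]
      nlinarith
    have hQ2 : ∫ b, grid τ γ (I b v) ^ 2 ∂μV ≤ ∫ b, Q (I b) ∂μV := by
      rw [h.integral_comp_eq v (fun i => grid τ γ (i v) ^ 2)]
      simp only [h.update_self]
      refine integral_mono_of_nonneg
        (Filter.Eventually.of_forall fun b => integral_nonneg fun s => sq_nonneg _)
        (h.integrable_comp Q) (Filter.Eventually.of_forall fun b => ?_)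
      simp only [Q, ← hD]
      exact integral_round_sq_le C (I b) hτ hγ (hx v) rfl
    have hDi : ∫ b, D (I b) ∂μV ≤ x v ^ 2 + 2 * x v * ∑ w ∈ C, X w +
        ∑ w ∈ C, ∑ w' ∈ C.erase w, X w * X w' := by
      simp only [D]
      rw [integral_add
          (h.integrable_comp fun i => x v ^ 2 + 2 * x v * ∑ w ∈ C, grid τ γ (i w))
          (h.integrable_comp fun i =>
            ∑ w ∈ C, ∑ w' ∈ C.erase w, grid τ γ (i w) * grid τ γ (i w')),
        integral_add (integrable_const _)
          (h.integrable_comp fun i => 2 * x v * ∑ w ∈ C, grid τ γ (i w)), integral_const_mul,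
        integral_finsetSum _ fun w _ => h.integrable_comp fun i => grid τ γ (i w),
        integral_finsetSum _ fun w _ => h.integrable_comp fun i =>
          ∑ w' ∈ C.erase w, grid τ γ (i w) * grid τ γ (i w')]
      have hxv := hx v
      gcongr with w hw w hw
      · simp
      · exact h.integral_le hτ hγ hx w
      · rw [integral_finsetSum _ fun w' _ => h.integrable_comp fun i =>
          grid τ γ (i w) * grid τ γ (i w')]
        refine Finset.sum_le_sum fun w' hw' => ?_
        obtain ⟨hne, hw'C⟩ := Finset.mem_erase.1 hw'
        have hdis := T.disjoint_subtree hw hw'C hne.symm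
        refine (h.integral_mul_le hτ hγ hx (fun i => grid τ γ (i w')) (fun _ => hn _) w
          fun a ha b s => ?_).trans
          (mul_le_mul_of_nonneg_left (h.integral_le hτ hγ hx w') (hX0 w))
        rw [h.idx_update (Finset.disjoint_left.1 hdis ha)]
    have hQi : ∫ b, Q (I b) ∂μV ≤ (1 + γ) * X v ^ 2 + τ * X v := by
      simp only [Q]
      rw [integral_add (h.integrable_comp fun i => (1 + γ) * D i + ∑ w ∈ C, grid τ γ (i w) ^ 2)
          (integrable_const _),
        integral_add (h.integrable_comp fun i => (1 + γ) * D i)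
          (h.integrable_comp fun i => ∑ w ∈ C, grid τ γ (i w) ^ 2), integral_const_mul,
        integral_finsetSum _ fun w _ => h.integrable_comp fun i => grid τ γ (i w) ^ 2]
      have h1 : ∑ w ∈ C, ∫ b, grid τ γ (I b w) ^ 2 ∂μV ≤
          ∑ w ∈ C, ((1 + γ) * X w ^ 2 + τ * X w) := Finset.sum_le_sum fun w hw => (ih w hw).2
      rw [Finset.sum_add_distrib, ← Finset.mul_sum, ← Finset.mul_sum] at h1
      have h2 : X v = x v + ∑ w ∈ C, X w := T.sum_subtree x v
      have h3 := sq_sum_eq_sum_erase C X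
      have h4 := mul_le_mul_of_nonneg_left hDi (by linarith : 0 ≤ 1 + γ)
      simp only [integral_const, probReal_univ, one_smul]
      rw [h2]
      nlinarith
    exact ⟨hQ1.trans hQi, hQ2.trans hQi⟩

/-- The bias caused by the finiteness of the grid. -/
lemma le_integral (h : IsTreeRounding T (grid τ γ) L x I) (hτ : 0 < τ) (hγ : 0 < γ)
    (hx : ∀ v, 0 ≤ x v) (hL : 0 < L) (v : V) :
    ∑ a ∈ T.subtree v, x a - (T.subtree v).card *
        (((1 + γ) * (∑ a, x a) ^ 2 + τ * ∑ a, x a) / grid τ γ L) ≤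
      ∫ b, grid τ γ (I b v) ∂μV := by
  have hn := grid_nonneg hτ hγ
  have hg := grid_strictMono hτ hγ
  have hgL : 0 < grid τ γ L := hg hL
  set B := (1 + γ) * (∑ a, x a) ^ 2 + τ * ∑ a, x a with hB
  induction v using T.induction_children with
  | h v ih =>
    set C := T.children v with hC
    have e1 : ∫ b, grid τ γ (I b v) ∂μV =
        ∫ b, min (x v + ∑ w ∈ C, grid τ γ (I b w)) (grid τ γ L) ∂μV := by
      rw [h.integral_comp_eq v (fun i => grid τ γ (i v))]
      congr 1
      ext b
      simp only [h.update_self]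
      rw [integral_round hg]
      exact add_nonneg (hx v) (Finset.sum_nonneg fun w _ => hn _)
    have e2 : ∫ b, (x v + ∑ w ∈ C, grid τ γ (I b w)) ∂μV -
        (∫ b, (x v + ∑ w ∈ C, grid τ γ (I b w)) ^ 2 ∂μV) / grid τ γ L ≤
          ∫ b, grid τ γ (I b v) ∂μV := by
      rw [e1, ← integral_div, ← integral_sub
        (h.integrable_comp fun i => x v + ∑ w ∈ C, grid τ γ (i w))
        (h.integrable_comp fun i => (x v + ∑ w ∈ C, grid τ γ (i w)) ^ 2 / grid τ γ L)]
      refine integral_mono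
        (h.integrable_comp fun i => (x v + ∑ w ∈ C, grid τ γ (i w)) -
          (x v + ∑ w ∈ C, grid τ γ (i w)) ^ 2 / grid τ γ L)
        (h.integrable_comp fun i => min (x v + ∑ w ∈ C, grid τ γ (i w)) (grid τ γ L))
        fun b => le_min ?_ ?_
      · exact sub_le_self _ (div_nonneg (sq_nonneg _) hgL.le)
      · rw [sub_le_iff_le_add, ← sub_le_iff_le_add', le_div_iff₀ hgL]
        nlinarith [sq_nonneg ((x v + ∑ w ∈ C, grid τ γ (I b w)) - grid τ γ L)]
    have hle : ∑ a ∈ T.subtree v, x a ≤ ∑ a, x a :=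
      Finset.sum_le_sum_of_subset_of_nonneg (Finset.subset_univ _) fun a _ _ => hx a
    have h0 : 0 ≤ ∑ a ∈ T.subtree v, x a := Finset.sum_nonneg fun a _ => hx a
    have e3 : ∫ b, (x v + ∑ w ∈ C, grid τ γ (I b w)) ^ 2 ∂μV ≤ B := by
      refine (h.integral_sq_le hτ hγ hx v).1.trans ?_
      rw [hB]
      gcongr
    have e4 := div_le_div_of_nonneg_right e3 hgL.le
    rw [integral_add (integrable_const _) (h.integrable_comp fun i => ∑ w ∈ C, grid τ γ (i w)),
      integral_finsetSum _ fun w _ => h.integrable_comp fun i => grid τ γ (i w)] at e2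
    simp only [integral_const, probReal_univ, one_smul] at e2
    have e5 := Finset.sum_le_sum ih
    rw [Finset.sum_sub_distrib, ← Finset.sum_mul] at e5
    have hcard : ((T.subtree v).card : ℝ) = 1 + ∑ w ∈ C, ((T.subtree w).card : ℝ) := by
      simpa using T.sum_subtree (fun _ => 1) v
    have hs := T.sum_subtree x v
    rw [hcard, hs]
    linarith

/-- The mean square error of the rounded total. -/
lemma integral_sub_sq_le (h : IsTreeRounding T (grid τ γ) L x I) (hτ : 0 < τ) (hγ : 0 < γ)
    (hx : ∀ v, 0 ≤ x v) (hL : 0 < L) {z : ℝ} (hz : z = ∑ a, x a) :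
    ∫ b, (grid τ γ (I b T.root) - z) ^ 2 ∂μV ≤ γ * z ^ 2 + τ * z +
      2 * z * (Fintype.card V * (((1 + γ) * z ^ 2 + τ * z) / grid τ γ L)) := by
  have h1 := (h.integral_sq_le hτ hγ hx T.root).2
  have h2 := h.le_integral hτ hγ hx hL T.root
  rw [T.subtree_root, ← hz] at h1 h2
  rw [Finset.card_univ] at h2
  have hz0 : 0 ≤ z := hz ▸ Finset.sum_nonneg fun a _ => hx a
  have e : ∫ b, (grid τ γ (I b T.root) - z) ^ 2 ∂μV =
      ∫ b, grid τ γ (I b T.root) ^ 2 ∂μV - 2 * z * ∫ b, grid τ γ (I b T.root) ∂μV + z ^ 2 := by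
    have : ∀ b, (grid τ γ (I b T.root) - z) ^ 2 =
        (grid τ γ (I b T.root) ^ 2 - 2 * z * grid τ γ (I b T.root)) + z ^ 2 := fun b => by ring
    simp only [this]
    rw [integral_add (h.integrable_comp fun i => grid τ γ (i T.root) ^ 2 -
        2 * z * grid τ γ (i T.root)) (integrable_const _),
      integral_sub (h.integrable_comp fun i => grid τ γ (i T.root) ^ 2)
        (h.integrable_comp fun i => 2 * z * grid τ γ (i T.root)), integral_const_mul]
    simp
  rw [e]
  nlinarith [mul_le_mul_of_nonneg_left h2 hz0]

end IsTreeRounding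

section

open Filter Topology

/-! ### Fractional moments from the Laplace transform -/

lemma integrableOn_rpow_mul_min {q r C : ℝ} (hq : 0 < q) (hqr : q < r) :
    IntegrableOn (fun t : ℝ => t ^ (-1 - q) * min 1 (|C| * t ^ r)) (Set.Ioi 0) := by
  have hm : Measurable fun t : ℝ => t ^ (-1 - q) * min 1 (|C| * t ^ r) := by fun_prop
  have hbd : ∀ t : ℝ, 0 < t → ‖t ^ (-1 - q) * min 1 (|C| * t ^ r)‖ =
      t ^ (-1 - q) * min 1 (|C| * t ^ r) := fun t ht => Real.norm_of_nonneg (by positivity)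
  rw [← Set.Ioc_union_Ioi_eq_Ioi zero_le_one]
  refine IntegrableOn.union ?_ ?_
  · have h : IntegrableOn (fun t : ℝ => |C| * t ^ (r - 1 - q)) (Set.Ioc 0 1) := by
      refine Integrable.const_mul ?_ _
      rw [← IntegrableOn, ← intervalIntegrable_iff_integrableOn_Ioc_of_le zero_le_one]
      exact intervalIntegral.intervalIntegrable_rpow' (by linarith)
    refine Integrable.mono' h hm.aestronglyMeasurable ?_
    filter_upwards [ae_restrict_mem measurableSet_Ioc] with t ht
    rw [hbd t ht.1]
    calc t ^ (-1 - q) * min 1 (|C| * t ^ r) ≤ t ^ (-1 - q) * (|C| * t ^ r) :=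
          mul_le_mul_of_nonneg_left (min_le_right _ _) (Real.rpow_nonneg ht.1.le _)
      _ = |C| * t ^ (r - 1 - q) := by
          rw [show r - 1 - q = (-1 - q) + r by ring, Real.rpow_add ht.1]; ring
  · refine Integrable.mono' (integrableOn_Ioi_rpow_of_lt (a := -1 - q) (by linarith) zero_lt_one)
      hm.aestronglyMeasurable ?_
    filter_upwards [ae_restrict_mem measurableSet_Ioi] with t ht
    have ht0 : 0 < t := zero_lt_one.trans ht
    rw [hbd t ht0]
    exact mul_le_of_le_one_right (Real.rpow_nonneg ht0.le _) (min_le_left _ _)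

lemma integral_rpow_mul_comp_mul (q : ℝ) (H : ℝ → ℝ) {s : ℝ} (hs : 0 < s) :
    ∫ t in Set.Ioi (0 : ℝ), t ^ (-1 - q) * H (s * t) =
      s ^ q * ∫ t in Set.Ioi (0 : ℝ), t ^ (-1 - q) * H t := by
  have h := integral_comp_mul_left_Ioi (fun t => t ^ (-1 - q) * H t) 0 hs
  rw [mul_zero, smul_eq_mul] at h
  have e : ∫ t in Set.Ioi (0 : ℝ), (s * t) ^ (-1 - q) * H (s * t) =
      s ^ (-1 - q) * ∫ t in Set.Ioi (0 : ℝ), t ^ (-1 - q) * H (s * t) := by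
    rw [← integral_const_mul]
    refine setIntegral_congr_fun measurableSet_Ioi fun t ht => ?_
    rw [Real.mul_rpow hs.le (le_of_lt ht)]
    ring
  rw [e] at h
  have h2 : s ^ q * s = s ^ (1 + q) := by rw [Real.rpow_add hs, Real.rpow_one, mul_comm]
  have h3 : s ^ (1 + q) * s ^ (-1 - q) = 1 := by
    rw [← Real.rpow_add hs]; norm_num
  calc _ = s ^ (1 + q) * (s ^ (-1 - q) * ∫ t in Set.Ioi (0 : ℝ), t ^ (-1 - q) * H (s * t)) := by
        rw [← mul_assoc, h3, one_mul]
    _ = _ := by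
        rw [h, ← h2]
        field_simp

/-- The normalizing constant in `z ^ q = (laplaceConst q)⁻¹ ∫ t ^ (-1 - q) (1 - exp (-tz)) dt`. -/
def laplaceConst (q : ℝ) : ℝ := ∫ t in Set.Ioi (0 : ℝ), t ^ (-1 - q) * (1 - Real.exp (-t))

lemma one_sub_exp_neg_nonneg {t : ℝ} (ht : 0 ≤ t) : 0 ≤ 1 - Real.exp (-t) :=
  sub_nonneg.2 (Real.exp_le_one_iff.2 (neg_nonpos.2 ht))

lemma one_sub_exp_neg_le_min (t : ℝ) : 1 - Real.exp (-t) ≤ min 1 t :=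
  le_min (by linarith [Real.exp_pos (-t)]) (by linarith [Real.add_one_le_exp (-t)])

/-- Integrability of `t ^ (-1 - q) * G t` if `G` is bounded by `min 1 (C t ^ r)` with `r > q`. -/
lemma integrableOn_rpow_mul {q r C : ℝ} (hq : 0 < q) (hqr : q < r) {G : ℝ → ℝ}
    (hG : Measurable G) (h0 : ∀ t, 0 < t → 0 ≤ G t) (h1 : ∀ t, 0 < t → G t ≤ min 1 (C * t ^ r)) :
    IntegrableOn (fun t : ℝ => t ^ (-1 - q) * G t) (Set.Ioi 0) := by
  refine (integrableOn_rpow_mul_min (C := C) hq hqr).mono'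
    ((by fun_prop : Measurable fun t : ℝ => t ^ (-1 - q) * G t).aestronglyMeasurable) ?_
  filter_upwards [ae_restrict_mem measurableSet_Ioi] with t ht
  have hp : 0 ≤ t ^ (-1 - q) := Real.rpow_nonneg (le_of_lt ht) _
  rw [Real.norm_of_nonneg (mul_nonneg hp (h0 t ht))]
  refine mul_le_mul_of_nonneg_left ((h1 t ht).trans (min_le_min le_rfl ?_)) hp
  exact mul_le_mul_of_nonneg_right (le_abs_self C) (Real.rpow_nonneg (le_of_lt ht) _)

lemma integral_rpow_mul_pos {q r C : ℝ} (hq : 0 < q) (hqr : q < r) {G : ℝ → ℝ}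
    (hG : Measurable G) (h0 : ∀ t, 0 < t → 0 < G t) (h1 : ∀ t, 0 < t → G t ≤ min 1 (C * t ^ r)) :
    0 < ∫ t in Set.Ioi (0 : ℝ), t ^ (-1 - q) * G t := by
  have hpos : ∀ t ∈ Set.Ioi (0 : ℝ), 0 < t ^ (-1 - q) * G t := fun t ht =>
    mul_pos (Real.rpow_pos_of_pos ht _) (h0 t ht)
  rw [setIntegral_pos_iff_support_of_nonneg_ae]
  · have : Function.support (fun t : ℝ => t ^ (-1 - q) * G t) ∩ Set.Ioi 0 = Set.Ioi 0 :=
      Set.inter_eq_right.2 fun t ht => (hpos t ht).ne'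
    rw [this]; simp
  · filter_upwards [ae_restrict_mem measurableSet_Ioi] with t ht using (hpos t ht).le
  · exact integrableOn_rpow_mul hq hqr hG (fun t ht => (h0 t ht).le) h1

lemma laplaceConst_pos {q : ℝ} (hq : 0 < q) (hq1 : q < 1) : 0 < laplaceConst q := by
  refine integral_rpow_mul_pos (C := 1) hq hq1 (by fun_prop) (fun t ht => ?_) fun t _ => ?_
  · exact sub_pos.2 (Real.exp_lt_one_iff.2 (by linarith))
  · simpa using one_sub_exp_neg_le_min t

lemma integral_rpow_mul_one_sub_exp {q : ℝ} (hq : 0 < q) {z : ℝ} (hz : 0 ≤ z) :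
    ∫ t in Set.Ioi (0 : ℝ), t ^ (-1 - q) * (1 - Real.exp (-(t * z))) =
      z ^ q * laplaceConst q := by
  rcases hz.eq_or_lt with rfl | hz
  · simp [Real.zero_rpow hq.ne']
  · rw [laplaceConst, ← integral_rpow_mul_comp_mul q (fun t => 1 - Real.exp (-t)) hz]
    simp only [mul_comm z]

/-- The fractional moments of a nonnegative random variable in terms of its Laplace transform. -/
lemma integral_rpow_eq_laplace {Ω : Type*} [MeasurableSpace Ω] {μ : Measure Ω}
    [IsProbabilityMeasure μ] {q r C : ℝ} (hq : 0 < q) (hq1 : q < 1) (hqr : q < r) {Z : Ω → ℝ}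
    (hZ : Measurable Z) (hZ0 : ∀ ω, 0 ≤ Z ω)
    (hC : ∀ t, 0 < t → ∫ ω, (1 - Real.exp (-(t * Z ω))) ∂μ ≤ C * t ^ r) :
    Integrable (fun ω => Z ω ^ q) μ ∧ (∫ ω, Z ω ^ q ∂μ) * laplaceConst q =
      ∫ t in Set.Ioi (0 : ℝ), t ^ (-1 - q) * ∫ ω, (1 - Real.exp (-(t * Z ω))) ∂μ := by
  have hI := laplaceConst_pos hq hq1
  have hint : ∀ t, 0 < t → Integrable (fun ω => 1 - Real.exp (-(t * Z ω))) μ := fun t ht => by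
    refine Integrable.of_bound (C := 1) (by fun_prop) (Eventually.of_forall fun ω => ?_)
    have h0 := mul_nonneg ht.le (hZ0 ω)
    rw [Real.norm_of_nonneg (one_sub_exp_neg_nonneg h0)]
    exact (one_sub_exp_neg_le_min _).trans (min_le_left _ _)
  set G : ℝ → ℝ := fun t => ∫ ω, (1 - Real.exp (-(t * Z ω))) ∂μ with hG
  have hGm : Measurable G := by
    have : StronglyMeasurable (fun p : ℝ × Ω => 1 - Real.exp (-(p.1 * Z p.2))) := by
      apply Measurable.stronglyMeasurable; fun_prop
    exact this.integral_prod_right.measurable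
  have hG0 : ∀ t, 0 < t → 0 ≤ G t := fun t ht =>
    integral_nonneg fun ω => one_sub_exp_neg_nonneg (mul_nonneg ht.le (hZ0 ω))
  have hG1 : ∀ t, 0 < t → G t ≤ min 1 (C * t ^ r) := fun t ht => by
    refine le_min ?_ (hC t ht)
    calc G t ≤ ∫ ω, (1 : ℝ) ∂μ := integral_mono (hint t ht) (integrable_const _)
          fun ω => (one_sub_exp_neg_le_min _).trans (min_le_left _ _)
      _ = 1 := by simp
  have hGi := integrableOn_rpow_mul hq hqr hGm hG0 hG1
  have hGn : 0 ≤ᵐ[volume.restrict (Set.Ioi (0 : ℝ))] fun t => t ^ (-1 - q) * G t := by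
    filter_upwards [ae_restrict_mem measurableSet_Ioi] with t ht
    exact mul_nonneg (Real.rpow_nonneg (le_of_lt ht) _) (hG0 t ht)
  have key : ∫⁻ ω, ENNReal.ofReal (Z ω ^ q * laplaceConst q) ∂μ =
      ENNReal.ofReal (∫ t in Set.Ioi (0 : ℝ), t ^ (-1 - q) * G t) := by
    rw [ofReal_integral_eq_lintegral_ofReal hGi hGn]
    have e1 : ∀ ω, ENNReal.ofReal (Z ω ^ q * laplaceConst q) =
        ∫⁻ t in Set.Ioi (0 : ℝ),
          ENNReal.ofReal (t ^ (-1 - q) * (1 - Real.exp (-(t * Z ω)))) := fun ω => by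
      rw [← integral_rpow_mul_one_sub_exp hq (hZ0 ω), ofReal_integral_eq_lintegral_ofReal]
      · refine integrableOn_rpow_mul (C := Z ω) hq hq1 (by fun_prop) (fun t ht => ?_) fun t _ => ?_
        · exact one_sub_exp_neg_nonneg (mul_nonneg ht.le (hZ0 ω))
        · simpa [mul_comm] using one_sub_exp_neg_le_min (t * Z ω)
      · filter_upwards [ae_restrict_mem measurableSet_Ioi] with t ht
        exact mul_nonneg (Real.rpow_nonneg (le_of_lt ht) _)
          (one_sub_exp_neg_nonneg (mul_nonneg (le_of_lt ht) (hZ0 ω)))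
    simp only [e1]
    rw [lintegral_lintegral_swap]
    · refine setLIntegral_congr_fun measurableSet_Ioi fun t ht => ?_
      have h0 : 0 ≤ t ^ (-1 - q) := Real.rpow_nonneg (le_of_lt ht) _
      simp only [hG]
      rw [← integral_const_mul, ofReal_integral_eq_lintegral_ofReal ((hint t ht).const_mul _)]
      exact Eventually.of_forall fun ω => mul_nonneg h0
        (one_sub_exp_neg_nonneg (mul_nonneg (le_of_lt ht) (hZ0 ω)))
    · apply Measurable.aemeasurable
      simp only [Function.uncurry_def]
      fun_prop
  have hn : ∀ ω, 0 ≤ Z ω ^ q * laplaceConst q := fun ω =>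
    mul_nonneg (Real.rpow_nonneg (hZ0 ω) _) hI.le
  have hm : AEStronglyMeasurable (fun ω => Z ω ^ q * laplaceConst q) μ := by
    apply Measurable.aestronglyMeasurable; fun_prop
  have hi : Integrable (fun ω => Z ω ^ q * laplaceConst q) μ := by
    refine ⟨hm, ?_⟩
    rw [hasFiniteIntegral_iff_ofReal (Eventually.of_forall hn), key]
    exact ENNReal.ofReal_lt_top
  refine ⟨?_, ?_⟩
  · have := hi.mul_const (laplaceConst q)⁻¹
    simpa [mul_assoc, hI.ne'] using this
  · rw [← integral_mul_const, integral_eq_lintegral_of_nonneg_ae (Eventually.of_forall hn) hm, key,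
      ENNReal.toReal_ofReal (integral_nonneg_of_ae hGn)]

end

section

open Filter Topology

/-! ### An approximately stable linear sketch -/

/-- The Laplace exponent density of the one-sided stable law. -/
def stableDensity (p v : ℝ) : ℝ := 1 - Real.exp (-(v ^ (-p⁻¹)))

lemma measurable_stableDensity (p : ℝ) : Measurable (stableDensity p) := by
  unfold stableDensity; fun_prop

lemma stableDensity_nonneg (p : ℝ) {v : ℝ} (hv : 0 < v) : 0 ≤ stableDensity p v :=
  one_sub_exp_neg_nonneg (Real.rpow_nonneg hv.le _)

lemma integrableOn_stableDensity {p : ℝ} (hp0 : 0 < p) (hp1 : p < 1) :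
    IntegrableOn (stableDensity p) (Set.Ioi 0) := by
  rw [← Set.Ioc_union_Ioi_eq_Ioi zero_le_one]
  refine IntegrableOn.union ?_ ?_
  · refine Integrable.mono' (integrable_const (1 : ℝ))
      (measurable_stableDensity p).aestronglyMeasurable ?_
    filter_upwards [ae_restrict_mem measurableSet_Ioc] with t ht
    rw [Real.norm_of_nonneg (stableDensity_nonneg p ht.1)]
    exact (one_sub_exp_neg_le_min _).trans (min_le_left _ _)
  · have hp : 1 < p⁻¹ := (one_lt_inv₀ hp0).2 hp1
    refine Integrable.mono' (integrableOn_Ioi_rpow_of_lt (a := -p⁻¹) (by linarith) zero_lt_one)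
      (measurable_stableDensity p).aestronglyMeasurable ?_
    filter_upwards [ae_restrict_mem measurableSet_Ioi] with t ht
    rw [Real.norm_of_nonneg (stableDensity_nonneg p (zero_lt_one.trans ht))]
    exact (one_sub_exp_neg_le_min _).trans (min_le_right _ _)

/-- The constant `c` in the Laplace transform `exp (-c t ^ p)` of the one-sided stable law. -/
def stableConst (p : ℝ) : ℝ := ∫ v in Set.Ioi (0 : ℝ), stableDensity p v

lemma stableConst_pos {p : ℝ} (hp0 : 0 < p) (hp1 : p < 1) : 0 < stableConst p := by
  have hpos : ∀ t ∈ Set.Ioi (0 : ℝ), 0 < stableDensity p t := fun t ht =>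
    sub_pos.2 (Real.exp_lt_one_iff.2 (neg_lt_zero.2 (Real.rpow_pos_of_pos ht _)))
  rw [stableConst, setIntegral_pos_iff_support_of_nonneg_ae]
  · have : Function.support (stableDensity p) ∩ Set.Ioi 0 = Set.Ioi 0 :=
      Set.inter_eq_right.2 fun t ht => (hpos t ht).ne'
    rw [this]; simp
  · filter_upwards [ae_restrict_mem measurableSet_Ioi] with t ht using (hpos t ht).le
  · exact integrableOn_stableDensity hp0 hp1

lemma mul_integral_one_sub_exp {p : ℝ} (hp0 : 0 < p) {s : ℝ} (hs : 0 < s) {N : ℕ} (hN : 0 < N) :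
    N * ∫ u, (1 - Real.exp (-(s * ((N : ℝ) ^ (-p⁻¹) * |u| ^ (-p⁻¹))))) ∂unif =
      s ^ p * ∫ v in (0 : ℝ)..(N / s ^ p), stableDensity p v := by
  have hN' : (0 : ℝ) < N := Nat.cast_pos.2 hN
  have hsp : 0 < s ^ p := Real.rpow_pos_of_pos hs p
  have hK : 0 < N / s ^ p := div_pos hN' hsp
  have e : ∫ u, (1 - Real.exp (-(s * ((N : ℝ) ^ (-p⁻¹) * |u| ^ (-p⁻¹))))) ∂unif =
      ∫ u in (0 : ℝ)..1, stableDensity p (N / s ^ p * u) := by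
    rw [unif, integral_Ico_eq_integral_Ioo, intervalIntegral.integral_of_le zero_le_one,
      integral_Ioc_eq_integral_Ioo]
    refine setIntegral_congr_fun measurableSet_Ioo fun u hu => ?_
    simp only [stableDensity]
    congr 3
    rw [abs_of_pos hu.1, Real.mul_rpow hK.le hu.1.le, Real.div_rpow hN'.le hsp.le,
      ← Real.rpow_mul hs.le, mul_neg, mul_inv_cancel₀ hp0.ne', Real.rpow_neg_one]
    field_simp
  rw [e, intervalIntegral.integral_comp_mul_left _ hK.ne', mul_zero, mul_one, smul_eq_mul]
  field_simp

lemma integral_stableDensity_le {p : ℝ} (hp0 : 0 < p) (hp1 : p < 1) {K : ℝ} (hK : 0 ≤ K) :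
    ∫ v in (0 : ℝ)..K, stableDensity p v ≤ stableConst p := by
  rw [intervalIntegral.integral_of_le hK, stableConst]
  refine setIntegral_mono_set (integrableOn_stableDensity hp0 hp1) ?_
    Set.Ioc_subset_Ioi_self.eventuallyLE
  filter_upwards [ae_restrict_mem measurableSet_Ioi] with t ht using stableDensity_nonneg p ht

/-- The Laplace exponent of one summand of the sketch. -/
def stepExponent (p : ℝ) (N : ℕ) (s : ℝ) : ℝ :=
  ∫ u, (1 - Real.exp (-(s * ((N : ℝ) ^ (-p⁻¹) * |u| ^ (-p⁻¹))))) ∂unif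

lemma stepExponent_zero (p : ℝ) (N : ℕ) : stepExponent p N 0 = 0 := by simp [stepExponent]

lemma mul_stepExponent_le {p : ℝ} (hp0 : 0 < p) (hp1 : p < 1) {s : ℝ} (hs : 0 ≤ s) {N : ℕ}
    (hN : 0 < N) : N * stepExponent p N s ≤ stableConst p * s ^ p := by
  rcases hs.eq_or_lt with rfl | hs
  · simp [stepExponent_zero, Real.zero_rpow hp0.ne']
  · rw [stepExponent, mul_integral_one_sub_exp hp0 hs hN, mul_comm]
    exact mul_le_mul_of_nonneg_right (integral_stableDensity_le hp0 hp1 (by positivity))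
      (by positivity)

lemma tendsto_mul_stepExponent {p : ℝ} (hp0 : 0 < p) (hp1 : p < 1) {s : ℝ} (hs : 0 ≤ s) :
    Tendsto (fun N : ℕ => N * stepExponent p N s) atTop (𝓝 (stableConst p * s ^ p)) := by
  rcases hs.eq_or_lt with rfl | hs
  · simp [stepExponent_zero, Real.zero_rpow hp0.ne']
  · have hsp : 0 < s ^ p := Real.rpow_pos_of_pos hs p
    have h1 : Tendsto (fun N : ℕ => (N : ℝ) / s ^ p) atTop atTop :=
      tendsto_natCast_atTop_atTop.atTop_div_const hsp
    have h2 := (intervalIntegral_tendsto_integral_Ioi 0 (integrableOn_stableDensity hp0 hp1)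
      h1).const_mul (s ^ p)
    rw [mul_comm (stableConst p)]
    refine h2.congr' ?_
    filter_upwards [eventually_gt_atTop 0] with N hN
    rw [stepExponent, mul_integral_one_sub_exp hp0 hs hN]

lemma integrable_exp_neg {Ω : Type*} [MeasurableSpace Ω] {μ : Measure Ω}
    [IsProbabilityMeasure μ] {f : Ω → ℝ} (hf : Measurable f) (h0 : ∀ ω, 0 ≤ f ω) :
    Integrable (fun ω => Real.exp (-f ω)) μ := by
  refine Integrable.of_bound (C := 1) (by fun_prop) (Eventually.of_forall fun ω => ?_)
  rw [Real.norm_of_nonneg (Real.exp_pos _).le]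
  exact Real.exp_le_one_iff.2 (neg_nonpos.2 (h0 ω))

lemma integral_exp_eq_one_sub_stepExponent (p : ℝ) (N : ℕ) {s : ℝ} (hs : 0 ≤ s) :
    ∫ u, Real.exp (-(s * ((N : ℝ) ^ (-p⁻¹) * |u| ^ (-p⁻¹)))) ∂unif = 1 - stepExponent p N s := by
  rw [stepExponent, integral_sub (integrable_const _)
    (integrable_exp_neg (by fun_prop) fun u => by positivity)]
  simp

/-- The multiplier of coordinate `i` in the sketch. -/
def sketchCoeff (p : ℝ) {n : ℕ} (N : ℕ) (a : Fin n × Fin N → ℝ) (i : Fin n) : ℝ :=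
  ∑ l, (N : ℝ) ^ (-p⁻¹) * |a (i, l)| ^ (-p⁻¹)

lemma sketchCoeff_nonneg (p : ℝ) {n N : ℕ} (a : Fin n × Fin N → ℝ) (i : Fin n) :
    0 ≤ sketchCoeff p N a i := Finset.sum_nonneg fun l _ => by positivity

lemma measurable_sketchCoeff (p : ℝ) {n N : ℕ} (i : Fin n) :
    Measurable fun a : Fin n × Fin N → ℝ => sketchCoeff p N a i := by
  unfold sketchCoeff; fun_prop

/-- The linear sketch of a vector. -/
def sketch (p : ℝ) {n : ℕ} (N : ℕ) (a : Fin n × Fin N → ℝ) (x : Fin n → ℕ) : ℝ :=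
  ∑ i, (x i : ℝ) * sketchCoeff p N a i

lemma sketch_nonneg (p : ℝ) {n N : ℕ} (a : Fin n × Fin N → ℝ) (x : Fin n → ℕ) :
    0 ≤ sketch p N a x :=
  Finset.sum_nonneg fun i _ => mul_nonneg (Nat.cast_nonneg _) (sketchCoeff_nonneg p a i)

lemma measurable_sketch (p : ℝ) {n N : ℕ} (x : Fin n → ℕ) :
    Measurable fun a : Fin n × Fin N → ℝ => sketch p N a x :=
  Finset.measurable_sum _ fun i _ => (measurable_sketchCoeff p i).const_mul _

lemma integral_exp_sketch (p : ℝ) {n : ℕ} (N : ℕ) (x : Fin n → ℕ) {t : ℝ} (ht : 0 ≤ t) :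
    ∫ a, Real.exp (-(t * sketch p N a x)) ∂(Measure.pi fun _ : Fin n × Fin N => unif) =
      ∏ i, (1 - stepExponent p N (t * x i)) ^ N := by
  have e : ∀ a : Fin n × Fin N → ℝ, Real.exp (-(t * sketch p N a x)) =
      ∏ j : Fin n × Fin N, Real.exp (-(t * x j.1 * ((N : ℝ) ^ (-p⁻¹) * |a j| ^ (-p⁻¹)))) := by
    intro a
    rw [← Real.exp_sum, Fintype.sum_prod_type, sketch, Finset.mul_sum, ← Finset.sum_neg_distrib]
    congr 1
    refine Finset.sum_congr rfl fun i _ => ?_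
    rw [sketchCoeff, Finset.mul_sum, Finset.mul_sum, ← Finset.sum_neg_distrib]
    exact Finset.sum_congr rfl fun l _ => by ring
  simp only [e]
  rw [integral_fintype_prod_eq_prod (μ := fun _ : Fin n × Fin N => unif)
    (fun (j : Fin n × Fin N) u => Real.exp (-(t * x j.1 * ((N : ℝ) ^ (-p⁻¹) * |u| ^ (-p⁻¹))))),
    Fintype.prod_prod_type]
  refine Finset.prod_congr rfl fun i _ => ?_
  simp only [integral_exp_eq_one_sub_stepExponent p N (mul_nonneg ht (Nat.cast_nonneg (x i)))]
  simp

lemma one_sub_prod_le_sum {ι : Type*} (s : Finset ι) (f : ι → ℝ) (h0 : ∀ i ∈ s, 0 ≤ f i)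
    (h1 : ∀ i ∈ s, f i ≤ 1) : 1 - ∏ i ∈ s, f i ≤ ∑ i ∈ s, (1 - f i) := by
  classical
  induction s using Finset.induction_on with
  | empty => simp
  | insert a s ha ih =>
    rw [Finset.prod_insert ha, Finset.sum_insert ha]
    have ih' := ih (fun i hi => h0 i (Finset.mem_insert_of_mem hi))
      (fun i hi => h1 i (Finset.mem_insert_of_mem hi))
    have hp : ∏ i ∈ s, f i ≤ 1 := Finset.prod_le_one
      (fun i hi => h0 i (Finset.mem_insert_of_mem hi))
      (fun i hi => h1 i (Finset.mem_insert_of_mem hi))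
    have ha0 := h0 a (Finset.mem_insert_self a s)
    have ha1 := h1 a (Finset.mem_insert_self a s)
    nlinarith

lemma stepExponent_nonneg (p : ℝ) (N : ℕ) {s : ℝ} (hs : 0 ≤ s) : 0 ≤ stepExponent p N s :=
  integral_nonneg fun u => one_sub_exp_neg_nonneg (by positivity)

lemma stepExponent_le_one (p : ℝ) (N : ℕ) {s : ℝ} (hs : 0 ≤ s) : stepExponent p N s ≤ 1 := by
  have h := integral_exp_eq_one_sub_stepExponent p N hs
  have : 0 ≤ ∫ u, Real.exp (-(s * ((N : ℝ) ^ (-p⁻¹) * |u| ^ (-p⁻¹)))) ∂unif :=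
    integral_nonneg fun u => (Real.exp_pos _).le
  linarith

lemma integral_one_sub_exp_sketch (p : ℝ) {n : ℕ} (N : ℕ) (x : Fin n → ℕ) {t : ℝ} (ht : 0 ≤ t) :
    ∫ a, (1 - Real.exp (-(t * sketch p N a x))) ∂(Measure.pi fun _ : Fin n × Fin N => unif) =
      1 - ∏ i, (1 - stepExponent p N (t * x i)) ^ N := by
  rw [integral_sub (integrable_const _) (integrable_exp_neg
    ((measurable_sketch p x).const_mul t) fun a => mul_nonneg ht (sketch_nonneg p a x)),
    integral_exp_sketch p N x ht]
  simp

lemma integral_one_sub_exp_sketch_le {p : ℝ} (hp0 : 0 < p) (hp1 : p < 1) {n N : ℕ} (hN : 0 < N)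
    (x : Fin n → ℕ) {t : ℝ} (ht : 0 ≤ t) :
    ∫ a, (1 - Real.exp (-(t * sketch p N a x))) ∂(Measure.pi fun _ : Fin n × Fin N => unif) ≤
      stableConst p * (∑ i, (x i : ℝ) ^ p) * t ^ p := by
  rw [integral_one_sub_exp_sketch p N x ht]
  have hs : ∀ i, 0 ≤ t * x i := fun i => mul_nonneg ht (Nat.cast_nonneg _)
  have h0 : ∀ i, 0 ≤ 1 - stepExponent p N (t * x i) := fun i =>
    sub_nonneg.2 (stepExponent_le_one p N (hs i))
  have h1 : ∀ i, 1 - stepExponent p N (t * x i) ≤ 1 := fun i =>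
    sub_le_self _ (stepExponent_nonneg p N (hs i))
  refine (one_sub_prod_le_sum _ _ (fun i _ => pow_nonneg (h0 i) N)
    (fun i _ => pow_le_one₀ (h0 i) (h1 i))).trans ?_
  rw [mul_assoc, Finset.sum_mul, Finset.mul_sum]
  refine Finset.sum_le_sum fun i _ => ?_
  have h2 := one_add_mul_le_pow (a := -stepExponent p N (t * x i)) (by linarith [h0 i]) N
  have h3 := mul_stepExponent_le hp0 hp1 (hs i) hN
  rw [Real.mul_rpow ht (Nat.cast_nonneg _)] at h3
  rw [← sub_eq_add_neg] at h2
  linarith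

lemma tendsto_integral_one_sub_exp_sketch {p : ℝ} (hp0 : 0 < p) (hp1 : p < 1) {n : ℕ}
    (x : Fin n → ℕ) {t : ℝ} (ht : 0 ≤ t) :
    Tendsto (fun N : ℕ => ∫ a, (1 - Real.exp (-(t * sketch p N a x)))
        ∂(Measure.pi fun _ : Fin n × Fin N => unif)) atTop
      (𝓝 (1 - Real.exp (-(stableConst p * (∑ i, (x i : ℝ) ^ p) * t ^ p)))) := by
  simp only [integral_one_sub_exp_sketch p _ x ht]
  refine tendsto_const_nhds.sub ?_
  have e : Real.exp (-(stableConst p * (∑ i, (x i : ℝ) ^ p) * t ^ p)) =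
      ∏ i, Real.exp (-(stableConst p * (t * x i) ^ p)) := by
    rw [← Real.exp_sum, Finset.sum_neg_distrib, mul_assoc, Finset.sum_mul, Finset.mul_sum]
    congr 2
    refine Finset.sum_congr rfl fun i _ => ?_
    rw [Real.mul_rpow ht (Nat.cast_nonneg _)]
    ring
  rw [e]
  refine tendsto_finsetProd _ fun i _ => ?_
  have h := tendsto_mul_stepExponent hp0 hp1 (mul_nonneg ht (Nat.cast_nonneg (x i)))
  simp only [sub_eq_add_neg]
  refine Real.tendsto_one_add_pow_exp_of_tendsto ?_
  simpa using h.neg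

lemma integral_rpow_mul_comp_mul_rpow {p q : ℝ} (hp0 : 0 < p) (hq : 0 < q) (H : ℝ → ℝ)
    (hH : H 0 = 0) {F : ℝ} (hF : 0 ≤ F) :
    ∫ t in Set.Ioi (0 : ℝ), t ^ (-1 - q) * H (F * t ^ p) =
      F ^ (q / p) * ∫ t in Set.Ioi (0 : ℝ), t ^ (-1 - q) * H (t ^ p) := by
  rcases hF.eq_or_lt with rfl | hF
  · simp [hH, Real.zero_rpow (div_pos hq hp0).ne']
  · have hs : 0 < F ^ p⁻¹ := Real.rpow_pos_of_pos hF _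
    have h := integral_rpow_mul_comp_mul q (fun t => H (t ^ p)) hs
    rw [← Real.rpow_mul hF.le, inv_mul_eq_div] at h
    rw [← h]
    refine setIntegral_congr_fun measurableSet_Ioi fun t ht => ?_
    rw [Real.mul_rpow hs.le (le_of_lt ht), ← Real.rpow_mul hF.le, inv_mul_cancel₀ hp0.ne',
      Real.rpow_one]

lemma sketch_moment_eq_laplace {p : ℝ} (hp0 : 0 < p) (hp1 : p < 1) {q : ℝ} (hq : 0 < q)
    (hqp : q < p) {n N : ℕ} (hN : 0 < N) (x : Fin n → ℕ) :
    Integrable (fun a => sketch p N a x ^ q) (Measure.pi fun _ : Fin n × Fin N => unif) ∧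
      (∫ a, sketch p N a x ^ q ∂(Measure.pi fun _ : Fin n × Fin N => unif)) * laplaceConst q =
        ∫ t in Set.Ioi (0 : ℝ), t ^ (-1 - q) * ∫ a, (1 - Real.exp (-(t * sketch p N a x)))
          ∂(Measure.pi fun _ : Fin n × Fin N => unif) :=
  integral_rpow_eq_laplace (C := stableConst p * ∑ i, (x i : ℝ) ^ p) hq (hqp.trans hp1) hqp
    (measurable_sketch p x) (fun a => sketch_nonneg p a x)
    (fun _ ht => integral_one_sub_exp_sketch_le hp0 hp1 hN x ht.le)

lemma integral_one_sub_exp_sketch_le_min {p : ℝ} (hp0 : 0 < p) (hp1 : p < 1) {n N : ℕ} (hN : 0 < N)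
    (x : Fin n → ℕ) {t : ℝ} (ht : 0 ≤ t) :
    ∫ a, (1 - Real.exp (-(t * sketch p N a x))) ∂(Measure.pi fun _ : Fin n × Fin N => unif) ≤
      min 1 (stableConst p * ((∑ i, (x i : ℝ) ^ p) * t ^ p)) := by
  refine le_min ?_ ?_
  · rw [integral_one_sub_exp_sketch p N x ht]
    refine sub_le_self _ (Finset.prod_nonneg fun i _ => pow_nonneg (sub_nonneg.2 ?_) _)
    exact stepExponent_le_one p N (mul_nonneg ht (Nat.cast_nonneg _))
  · rw [← mul_assoc]
    exact integral_one_sub_exp_sketch_le hp0 hp1 hN x ht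

lemma integral_one_sub_exp_sketch_nonneg (p : ℝ) {n N : ℕ} (x : Fin n → ℕ) {t : ℝ} (ht : 0 ≤ t) :
    0 ≤ ∫ a, (1 - Real.exp (-(t * sketch p N a x))) ∂(Measure.pi fun _ : Fin n × Fin N => unif) :=
  integral_nonneg fun a => one_sub_exp_neg_nonneg (mul_nonneg ht (sketch_nonneg p a x))

lemma measurable_integral_one_sub_exp_sketch (p : ℝ) {n N : ℕ} (x : Fin n → ℕ) :
    Measurable fun t : ℝ => ∫ a, (1 - Real.exp (-(t * sketch p N a x)))
      ∂(Measure.pi fun _ : Fin n × Fin N => unif) := by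
  have hs := measurable_sketch p (N := N) x
  have : StronglyMeasurable (fun w : ℝ × (Fin n × Fin N → ℝ) =>
      1 - Real.exp (-(w.1 * sketch p N w.2 x))) := by
    apply Measurable.stronglyMeasurable; fun_prop
  exact this.integral_prod_right.measurable

/-- Uniform bounds for the fractional moments of the sketch. -/
lemma exists_integral_sketch_rpow_le {p : ℝ} (hp0 : 0 < p) (hp1 : p < 1) {q : ℝ} (hq : 0 < q)
    (hqp : q < p) : ∃ C : ℝ, 0 < C ∧ ∀ {n N : ℕ}, 0 < N → ∀ x : Fin n → ℕ,
      Integrable (fun a => sketch p N a x ^ q) (Measure.pi fun _ : Fin n × Fin N => unif) ∧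
      ∫ a, sketch p N a x ^ q ∂(Measure.pi fun _ : Fin n × Fin N => unif) ≤
        C * (∑ i, (x i : ℝ) ^ p) ^ (q / p) := by
  have hI := laplaceConst_pos hq (hqp.trans hp1)
  have hc := stableConst_pos hp0 hp1
  set J := ∫ t in Set.Ioi (0 : ℝ), t ^ (-1 - q) * min 1 (stableConst p * t ^ p) with hJ
  have hJpos : 0 < J := integral_rpow_mul_pos (C := stableConst p) hq hqp (by fun_prop)
    (fun t ht => lt_min one_pos (mul_pos hc (Real.rpow_pos_of_pos ht _))) fun t _ => le_rfl
  refine ⟨J / laplaceConst q, div_pos hJpos hI, fun {n N} hN x => ?_⟩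
  obtain ⟨h1, h2⟩ := sketch_moment_eq_laplace hp0 hp1 hq hqp hN x
  refine ⟨h1, ?_⟩
  set F := ∑ i, (x i : ℝ) ^ p with hF
  have hF0 : 0 ≤ F := Finset.sum_nonneg fun i _ => Real.rpow_nonneg (Nat.cast_nonneg _) _
  have hmin := integral_rpow_mul_comp_mul_rpow hp0 hq (fun y => min 1 (stableConst p * y))
    (by simp) hF0
  rw [div_mul_eq_mul_div, le_div_iff₀ hI, h2, mul_comm J, hJ, ← hmin]
  refine setIntegral_mono_on
    (integrableOn_rpow_mul (C := stableConst p * F) hq hqp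
      (measurable_integral_one_sub_exp_sketch p x)
      (fun t ht => integral_one_sub_exp_sketch_nonneg p x ht.le) fun t ht => ?_)
    (integrableOn_rpow_mul (C := stableConst p * F) hq hqp (by fun_prop)
      (fun t ht => by positivity) fun t _ => by rw [mul_assoc])
    measurableSet_Ioi fun t ht => ?_
  · rw [mul_assoc]
    exact integral_one_sub_exp_sketch_le_min hp0 hp1 hN x ht.le
  · exact mul_le_mul_of_nonneg_left
      (integral_one_sub_exp_sketch_le_min hp0 hp1 hN x (le_of_lt ht))
      (Real.rpow_nonneg (le_of_lt ht) _)

/-- The fractional moments of the sketch converge to those of the stable law. -/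
lemma exists_tendsto_integral_sketch_rpow {p : ℝ} (hp0 : 0 < p) (hp1 : p < 1) {q : ℝ} (hq : 0 < q)
    (hqp : q < p) : ∃ C : ℝ, 0 < C ∧ ∀ {n : ℕ} (x : Fin n → ℕ),
      Tendsto (fun N : ℕ => ∫ a, sketch p N a x ^ q ∂(Measure.pi fun _ : Fin n × Fin N => unif))
        atTop (𝓝 (C * (∑ i, (x i : ℝ) ^ p) ^ (q / p))) := by
  have hI := laplaceConst_pos hq (hqp.trans hp1)
  have hc := stableConst_pos hp0 hp1
  set J := ∫ t in Set.Ioi (0 : ℝ), t ^ (-1 - q) * (1 - Real.exp (-(stableConst p * t ^ p))) with hJ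
  have hJpos : 0 < J := integral_rpow_mul_pos (C := stableConst p) hq hqp (by fun_prop)
    (fun t ht => sub_pos.2 (Real.exp_lt_one_iff.2 (neg_lt_zero.2
      (mul_pos hc (Real.rpow_pos_of_pos ht _))))) fun t _ => one_sub_exp_neg_le_min _
  refine ⟨J / laplaceConst q, div_pos hJpos hI, fun {n} x => ?_⟩
  set F := ∑ i, (x i : ℝ) ^ p with hF
  have hF0 : 0 ≤ F := Finset.sum_nonneg fun i _ => Real.rpow_nonneg (Nat.cast_nonneg _) _
  have hlim := integral_rpow_mul_comp_mul_rpow hp0 hq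
    (fun y => 1 - Real.exp (-(stableConst p * y))) (by simp) hF0
  have key : Tendsto (fun N : ℕ => ∫ t in Set.Ioi (0 : ℝ), t ^ (-1 - q) *
      ∫ a, (1 - Real.exp (-(t * sketch p N a x))) ∂(Measure.pi fun _ : Fin n × Fin N => unif)) atTop
      (𝓝 (∫ t in Set.Ioi (0 : ℝ), t ^ (-1 - q) *
        (1 - Real.exp (-(stableConst p * (F * t ^ p)))))) := by
    refine tendsto_integral_filter_of_dominated_convergence
      (fun t => t ^ (-1 - q) * min 1 (|stableConst p * F| * t ^ p)) ?_ ?_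
      (integrableOn_rpow_mul_min hq hqp) ?_
    · exact Eventually.of_forall fun N => ((Measurable.pow_const measurable_id _).mul
        (measurable_integral_one_sub_exp_sketch p x)).aestronglyMeasurable
    · filter_upwards [eventually_gt_atTop 0] with N hN
      filter_upwards [ae_restrict_mem measurableSet_Ioi] with t ht
      have ht0 : 0 ≤ t := le_of_lt ht
      rw [Real.norm_of_nonneg (mul_nonneg (Real.rpow_nonneg ht0 _)
        (integral_one_sub_exp_sketch_nonneg p x ht0)),
        abs_of_nonneg (mul_nonneg hc.le hF0), mul_assoc (stableConst p)]
      exact mul_le_mul_of_nonneg_left (integral_one_sub_exp_sketch_le_min hp0 hp1 hN x ht0)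
        (Real.rpow_nonneg ht0 _)
    · filter_upwards [ae_restrict_mem measurableSet_Ioi] with t ht
      have h := tendsto_integral_one_sub_exp_sketch hp0 hp1 x (le_of_lt ht)
      rw [mul_assoc (stableConst p)] at h
      exact h.const_mul _
  rw [hlim] at key
  have key2 := key.div_const (laplaceConst q)
  rw [mul_comm, mul_div_right_comm] at key2
  refine key2.congr' ?_
  filter_upwards [eventually_gt_atTop 0] with N hN
  rw [div_eq_iff hI.ne', (sketch_moment_eq_laplace hp0 hp1 hq hqp hN x).2]

end

/-! ### The rounded sums on a tree -/

section

variable {V : Type*} [Fintype V] [DecidableEq V] (T : RootedTree V)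

/-- The largest depth of a vertex. -/
def RootedTree.maxDepth : ℕ := Finset.univ.sup T.depth

lemma RootedTree.depth_le_maxDepth (v : V) : T.depth v ≤ T.maxDepth :=
  Finset.le_sup (Finset.mem_univ v)

/-- Rounded sums on a tree, computed up to a given height. -/
def treeIdxAux (g : ℕ → ℝ) (L : ℕ) (x b : V → ℝ) : ℕ → V → ℕ
  | 0, _ => 0
  | k + 1, v => roundIdx g L (x v + ∑ w ∈ T.children v, g (treeIdxAux g L x b k w)) (b v)

/-- The grid index at vertex `v` if every vertex adds its own number to the grid points obtained
from its children and rounds the sum. -/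
def treeIdx (g : ℕ → ℝ) (L : ℕ) (x b : V → ℝ) (v : V) : ℕ :=
  treeIdxAux T g L x b (T.maxDepth - T.depth v + 1) v

lemma treeIdx_eq (g : ℕ → ℝ) (L : ℕ) (x b : V → ℝ) (v : V) :
    treeIdx T g L x b v =
      roundIdx g L (x v + ∑ w ∈ T.children v, g (treeIdx T g L x b w)) (b v) := by
  rw [treeIdx, treeIdxAux]
  congr 2
  refine Finset.sum_congr rfl fun w hw => ?_
  have h1 := T.depth_of_mem_children hw
  have h2 := T.depth_le_maxDepth w
  rw [treeIdx, show T.maxDepth - T.depth v = T.maxDepth - T.depth w + 1 by omega]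

lemma isTreeRounding_treeIdx (g : ℕ → ℝ) (L : ℕ) (x : V → ℝ) :
    IsTreeRounding T g L x (treeIdx T g L x) := fun b v => treeIdx_eq T g L x b v

lemma measurable_treeIdx (g : ℕ → ℝ) (L : ℕ) (v : V) :
    Measurable fun p : (V → ℝ) × (V → ℝ) => treeIdx T g L p.1 p.2 v := by
  induction v using T.induction_children with
  | h v ih =>
    have e : (fun p : (V → ℝ) × (V → ℝ) => treeIdx T g L p.1 p.2 v) =
        (fun p : ℝ × ℝ => roundIdx g L p.1 p.2) ∘ fun p : (V → ℝ) × (V → ℝ) =>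
          (p.1 v + ∑ w ∈ T.children v, g (treeIdx T g L p.1 p.2 w), p.2 v) :=
      funext fun p => treeIdx_eq T g L p.1 p.2 v
    rw [e]
    refine (measurable_roundIdx g L).comp (Measurable.prodMk ?_ ?_)
    · exact ((measurable_pi_apply v).comp measurable_fst).add
        (Finset.measurable_sum _ fun w hw => (measurable_of_countable g).comp (ih w hw))
    · exact (measurable_pi_apply v).comp measurable_snd

lemma treeIdx_zero {g : ℕ → ℝ} (hg : Monotone g) (h0 : g 0 = 0) (L : ℕ) (b : V → ℝ) (v : V) :
    treeIdx T g L (fun _ => 0) b v = 0 := by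
  induction v using T.induction_children with
  | h v ih =>
    rw [treeIdx_eq, Finset.sum_eq_zero fun w hw => by rw [ih w hw, h0], add_zero,
      roundIdx_zero hg h0]

end

/-! ### The protocol -/

lemma exists_encoding {k A ℓ : ℕ} (h : A ^ k ≤ 2 ^ ℓ) :
    ∃ (enc : (Fin k → Fin A) → List Bool) (dec : List Bool → Fin k → ℕ),
      (∀ x, (enc x).length = ℓ) ∧ ∀ x j, dec (enc x) j = x j := by
  classical
  obtain ⟨f⟩ : Nonempty ((Fin k → Fin A) ↪ (Fin ℓ → Bool)) :=
    Function.Embedding.nonempty_of_card_le (by simpa using h)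
  let enc : (Fin k → Fin A) → List Bool := fun x => List.ofFn (f x)
  have hinj : Function.Injective enc := List.ofFn_injective.comp f.injective
  refine ⟨enc, fun s j => if h : ∃ x, enc x = s then (h.choose j : ℕ) else 0, fun x => by simp [enc],
    fun x j => ?_⟩
  have hx : ∃ y, enc y = enc x := ⟨x, rfl⟩
  simp only [dif_pos hx]
  rw [hinj hx.choose_spec]

lemma exists_bfs_tree {m : ℕ} {G : SimpleGraph (Fin m)} (hG : G.Connected) :
    ∃ T : RootedTree (Fin m), (∀ v, v ≠ T.root → G.Adj v (T.parent v)) ∧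
      T.maxDepth ≤ G.diam := by
  classical
  obtain ⟨c⟩ := hG.nonempty
  have hstep : ∀ v, v ≠ c → ∃ w, G.Adj v w ∧ G.dist v c = G.dist w c + 1 := by
    intro v hv
    obtain ⟨W, hW⟩ := hG.exists_walk_length_eq_dist v c
    cases W with
    | nil => exact absurd rfl hv
    | @cons _ w _ hadj W =>
      refine ⟨w, hadj, le_antisymm ?_ ?_⟩
      · have h1 := hG.dist_triangle (u := v) (v := w) (w := c)
        rw [SimpleGraph.dist_eq_one_iff_adj.2 hadj] at h1
        omega
      · have h2 := SimpleGraph.dist_le W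
        rw [SimpleGraph.Walk.length_cons] at hW
        omega
  choose! par hadj hdist using hstep
  refine ⟨⟨c, fun v => if v = c then c else par v, fun v => G.dist v c, by simp, by simp,
    fun v hv => by simpa [hv] using hdist v hv⟩, fun v hv => ?_, ?_⟩
  · simpa [hv] using hadj v hv
  · refine Finset.sup_le fun v _ => SimpleGraph.dist_le_diam ?_
    have := hG.nonempty
    exact SimpleGraph.connected_iff_ediam_ne_top.1 hG

/-- The data of a tree protocol: `k` counters on the grid `g`, an aggregation tree, the multipliers
`coef` and the rounding coins `rnd` obtained from the public coins, an encoding of the counters as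
bit strings, and the final estimator `est`. -/
structure TreeProtocolData {m : ℕ} (G : SimpleGraph (Fin m)) (n M : ℕ) where
  k : ℕ
  L : ℕ
  len : ℕ
  g : ℕ → ℝ
  tree : RootedTree (Fin m)
  adj_parent : ∀ v, v ≠ tree.root → G.Adj v (tree.parent v)
  coef : Coins → Fin k → Fin n → ℝ
  measurable_coef : ∀ j i, Measurable fun ω => coef ω j i
  rnd : Coins → Fin k → Fin m → ℝ
  measurable_rnd : ∀ j v, Measurable fun ω => rnd ω j v
  enc : (Fin k → Fin (L + 1)) → List Bool
  dec : List Bool → Fin k → ℕ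
  length_enc : ∀ x, (enc x).length = len
  dec_enc : ∀ x j, dec (enc x) j = x j
  est : (Fin k → ℕ) → ℝ

namespace TreeProtocolData

variable {m n M : ℕ} {G : SimpleGraph (Fin m)} (A : TreeProtocolData G n M)

/-- The sum of the grid points received so far for counter `j`. -/
def received (h : Inbox m) (j : Fin A.k) : ℝ :=
  (h.map fun e => ∑ u, (e u).elim 0 fun s => A.g (A.dec s j)).sum

/-- The sketch of the own input of a player. -/
def own (ω : Coins) (x : Input n M) (j : Fin A.k) : ℝ := ∑ i, ((x i : ℕ) : ℝ) * A.coef ω j i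

/-- The counters of player `v`. -/
def counter (v : Fin m) (ω : Coins) (x : Input n M) (h : Inbox m) (j : Fin A.k) : ℕ :=
  roundIdx A.g A.L (A.own ω x j + A.received h j) (A.rnd ω j v)

lemma measurable_counter (v : Fin m) (x : Input n M) (h : Inbox m) :
    Measurable fun ω => A.counter v ω x h := by
  refine measurable_pi_lambda _ fun j => ?_
  refine (measurable_roundIdx A.g A.L).comp (Measurable.prodMk ?_ (A.measurable_rnd j v))
  exact (Finset.measurable_sum _ fun i _ => (A.measurable_coef j i).const_mul _).add_const _

/-- The message of player `v`. -/
def msg (v : Fin m) (ω : Coins) (x : Input n M) (h : Inbox m) : List Bool :=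
  A.enc fun j => ⟨A.counter v ω x h j, Nat.lt_succ_of_le (roundIdx_le _ _ _ _)⟩

open Classical in
/-- The protocol in which every player sends its counters to its parent in the tree. -/
def protocol : Protocol G n M where
  rounds := A.tree.maxDepth
  center := A.tree.root
  schedule r v := if v ≠ A.tree.root ∧ r + A.tree.depth v = A.tree.maxDepth then
    some (A.tree.parent v) else none
  adj_of_schedule r v w h := by
    split_ifs at h with hv
    rw [← Option.some.inj h]
    exact A.adj_parent v hv.1
  message _ v ω x h := A.msg v ω x h
  output ω x h := A.est (A.counter A.tree.root ω x h)
  measurable_message _ v x h s := by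
    have h1 : Measurable fun ω => fun j =>
        (⟨A.counter v ω x h j, Nat.lt_succ_of_le (roundIdx_le _ _ _ _)⟩ : Fin (A.L + 1)) := by
      refine measurable_pi_lambda _ fun j => ?_
      have h2 : Measurable fun ω => A.counter v ω x h j :=
        (measurable_pi_apply j).comp (A.measurable_counter v x h)
      refine measurable_to_countable' fun i => ?_
      convert h2 (measurableSet_singleton (i : ℕ)) using 1
      ext ω
      simp [Fin.ext_iff]
    exact h1 (Set.toFinite {y | A.enc y = s}).measurableSet
  measurable_output x h := (measurable_of_countable A.est).comp (A.measurable_counter _ x h)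

lemma schedule_eq_some {r : ℕ} {v w : Fin m} :
    A.protocol.schedule r v = some w ↔
      v ≠ A.tree.root ∧ r + A.tree.depth v = A.tree.maxDepth ∧ A.tree.parent v = w := by
  simp only [protocol]
  split_ifs with h
  · simp [h]
  · simp only [false_iff]
    tauto

lemma isOneShot : A.protocol.IsOneShot := by
  have hsome : ∀ r v, (A.protocol.schedule r v).isSome ↔
      v ≠ A.tree.root ∧ r + A.tree.depth v = A.tree.maxDepth := fun r v => by
    simp [Option.isSome_iff_exists, A.schedule_eq_some]
  refine ⟨fun v hv => ?_, fun r _ => ?_, fun r _ s _ u w v hu hw => ?_,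
    fun r _ s _ u v hu hv => ?_⟩
  · have h1 := A.tree.depth_parent v hv
    have h2 := A.tree.depth_le_maxDepth v
    refine ⟨A.tree.maxDepth - A.tree.depth v, ⟨?_, (hsome _ _).2 ⟨hv, by omega⟩⟩, ?_⟩
    · change _ < A.tree.maxDepth
      omega
    · rintro r ⟨_, hr⟩
      have := ((hsome _ _).1 hr).2
      omega
  · simp [protocol]
  · obtain ⟨h1, h2, h3⟩ := A.schedule_eq_some.1 hu
    obtain ⟨h4, h5, h6⟩ := A.schedule_eq_some.1 hw
    have h7 := A.tree.depth_parent u h1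
    have h8 := A.tree.depth_parent w h4
    rw [h3] at h7
    rw [h6] at h8
    omega
  · obtain ⟨h1, h2, h3⟩ := A.schedule_eq_some.1 hu
    obtain ⟨h4, h5⟩ := (hsome _ _).1 hv
    have h7 := A.tree.depth_parent u h1
    rw [h3] at h7
    omega

lemma dec_msg (v : Fin m) (ω : Coins) (x : Input n M) (h : Inbox m) (j : Fin A.k) :
    A.dec (A.msg v ω x h) j = A.counter v ω x h j := A.dec_enc _ _

lemma received_inbox (X : Fin m → Input n M) (ω : Coins) (r : ℕ) (v : Fin m) (j : Fin A.k) :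
    A.received (A.protocol.inbox X ω r v) j = ∑ s ∈ Finset.range r, ∑ u,
      if u ≠ A.tree.root ∧ s + A.tree.depth u = A.tree.maxDepth ∧ A.tree.parent u = v then
        A.g (A.counter u ω (X u) (A.protocol.inbox X ω s u) j) else 0 := by
  induction r with
  | zero => simp [Protocol.inbox, received]
  | succ r ih =>
    rw [Finset.sum_range_succ, ← ih, Protocol.inbox, received, List.map_append, List.sum_append]
    congr 1
    simp only [List.map_cons, List.map_nil, List.sum_cons, List.sum_nil, add_zero,
      A.schedule_eq_some]
    refine Finset.sum_congr rfl fun u _ => ?_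
    split_ifs with h
    · exact congrArg A.g (A.dec_msg u ω (X u) _ j)
    · rfl

/-- In an execution, the counters of every player are the rounded sums on the tree. -/
lemma counter_eq_treeIdx (X : Fin m → Input n M) (ω : Coins) (j : Fin A.k) (v : Fin m) :
    A.counter v ω (X v) (A.protocol.inbox X ω (A.tree.maxDepth - A.tree.depth v) v) j =
      treeIdx A.tree A.g A.L (fun w => A.own ω (X w) j) (A.rnd ω j) v := by
  induction v using A.tree.induction_children with
  | h v ih =>
    rw [counter, treeIdx_eq, received_inbox, Finset.sum_comm]
    congr 2
    rw [RootedTree.children, Finset.sum_filter]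
    refine Finset.sum_congr rfl fun u _ => ?_
    split_ifs with h
    · have hu := A.tree.mem_children.2 h
      have h1 := A.tree.depth_of_mem_children hu
      have h2 := A.tree.depth_le_maxDepth u
      rw [Finset.sum_eq_single_of_mem (A.tree.maxDepth - A.tree.depth u)
        (Finset.mem_range.2 (by omega)), if_pos ⟨h.1, by omega, h.2⟩, ih u hu]
      intro s _ hs
      rw [if_neg]
      rintro ⟨_, h3, _⟩
      omega
    · exact Finset.sum_eq_zero fun s _ => if_neg fun h' => h ⟨h'.1, h'.2.2⟩

lemma result_eq (X : Fin m → Input n M) (ω : Coins) :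
    A.protocol.result X ω = A.est fun j =>
      treeIdx A.tree A.g A.L (fun w => A.own ω (X w) j) (A.rnd ω j) A.tree.root := by
  have h : A.protocol.result X ω = A.est (A.counter A.tree.root ω (X A.tree.root)
      (A.protocol.inbox X ω A.tree.maxDepth A.tree.root)) := rfl
  rw [h]
  congr 1
  ext j
  rw [← A.counter_eq_treeIdx X ω j A.tree.root, A.tree.depth_root, Nat.sub_zero]

lemma bits_le (X : Fin m → Input n M) (ω : Coins) (r : ℕ) (u v : Fin m) :
    A.protocol.bits X ω r u v ≤
      if r = A.tree.maxDepth - A.tree.depth u then (if A.tree.parent u = v then A.len else 0)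
        else 0 := by
  rw [Protocol.bits]
  split_ifs with h h1 h2 h2
  · exact (A.length_enc _).le
  · exact absurd (A.schedule_eq_some.1 h).2.2 h2
  · exact absurd (by have := (A.schedule_eq_some.1 h).2.1; omega) h1
  all_goals exact Nat.zero_le _

lemma sum_bits_le (X : Fin m → Input n M) (ω : Coins) (R : ℕ) (u v : Fin m) :
    ∑ r ∈ Finset.range R, A.protocol.bits X ω r u v ≤ if A.tree.parent u = v then A.len else 0 := by
  refine (Finset.sum_le_sum fun r _ => A.bits_le X ω r u v).trans ?_
  rw [Finset.sum_ite_eq']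
  split_ifs <;> simp

lemma totalCommunication_le (X : Fin m → Input n M) (ω : Coins) :
    A.protocol.totalCommunication X ω ≤ m * A.len := by
  rw [Protocol.totalCommunication, Finset.sum_comm]
  calc ∑ u, ∑ r ∈ Finset.range A.protocol.rounds, ∑ v, A.protocol.bits X ω r u v
      ≤ ∑ u : Fin m, A.len := Finset.sum_le_sum fun u _ => by
        rw [Finset.sum_comm]
        refine (Finset.sum_le_sum fun v _ => A.sum_bits_le X ω _ u v).trans ?_
        simp
    _ = m * A.len := by simp

lemma maxCommunication_le (X : Fin m → Input n M) (ω : Coins) :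
    A.protocol.maxCommunication X ω ≤ 2 * A.len := by
  refine Finset.sup_le fun e _ => ?_
  rw [Protocol.edgeCommunication, Finset.sum_add_distrib, two_mul]
  refine add_le_add ((A.sum_bits_le X ω _ _ _).trans ?_) ((A.sum_bits_le X ω _ _ _).trans ?_) <;>
  split_ifs <;> simp

end TreeProtocolData

section

open Filter

/-! ### Powers of approximate values -/

lemma rpow_le_add_mul {w s q : ℝ} (hw : 0 ≤ w) (hs : 0 < s) (hq0 : 0 ≤ q) (hq1 : q ≤ 1) :
    w ^ q ≤ s ^ q + s ^ (q - 1) * w := by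
  rcases le_or_gt w s with h | h
  · have := Real.rpow_le_rpow hw h hq0
    have : 0 ≤ s ^ (q - 1) * w := by positivity
    linarith
  · have hw' : 0 < w := hs.trans h
    have h1 : w ^ q = w ^ (q - 1) * w := by
      rw [← Real.rpow_add_one hw'.ne']; norm_num
    have h2 : w ^ (q - 1) ≤ s ^ (q - 1) := Real.rpow_le_rpow_of_nonpos hs h.le (by linarith)
    have h3 : 0 ≤ s ^ q := by positivity
    nlinarith

lemma rpow_sub_rpow_sq_le {y z q : ℝ} (hy : 0 ≤ y) (hz : 0 < z) (hq0 : 0 ≤ q) (hq1 : q ≤ 1) :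
    (y ^ q - z ^ q) ^ 2 ≤ z ^ (2 * q - 2) * (y - z) ^ 2 := by
  obtain ⟨r, hr, rfl⟩ : ∃ r, 0 ≤ r ∧ y = z * r := ⟨y / z, by positivity, by field_simp⟩
  have h1 : (r ^ q - 1) ^ 2 ≤ (r - 1) ^ 2 := by
    rw [sq_le_sq]
    rcases le_total r 1 with h | h
    · have h2 : r ^ q ≤ 1 := Real.rpow_le_one hr h hq0
      have h3 : r ≤ r ^ q := by
        rcases hr.eq_or_lt with rfl | hr'
        · positivity
        · simpa using Real.rpow_le_rpow_of_exponent_ge hr' h hq1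
      rw [abs_of_nonpos (by linarith), abs_of_nonpos (by linarith)]
      linarith
    · have h2 : 1 ≤ r ^ q := Real.one_le_rpow h hq0
      have h3 : r ^ q ≤ r := by simpa using Real.rpow_le_rpow_of_exponent_le h hq1
      rw [abs_of_nonneg (by linarith), abs_of_nonneg (by linarith)]
      linarith
  have e1 : (z ^ q) ^ 2 = z ^ (2 * q - 2) * z ^ 2 := by
    rw [← Real.rpow_natCast, ← Real.rpow_mul hz.le, ← Real.rpow_natCast z, ← Real.rpow_add hz]
    congr 1; push_cast; ring
  rw [Real.mul_rpow hz.le hr]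
  calc (z ^ q * r ^ q - z ^ q) ^ 2 = (z ^ q) ^ 2 * (r ^ q - 1) ^ 2 := by ring
    _ ≤ (z ^ q) ^ 2 * (r - 1) ^ 2 := by gcongr
    _ = z ^ (2 * q - 2) * (z * r - z) ^ 2 := by rw [e1]; ring

lemma rpow_sub_rpow_sq_le_abs {y z q : ℝ} (hy : 0 ≤ y) (hz : 0 ≤ z) (hq0 : 0 ≤ q) (hq1 : q ≤ 1) :
    (y ^ q - z ^ q) ^ 2 ≤ ((y - z) ^ 2) ^ q := by
  wlog h : z ≤ y generalizing y z
  · have := this hz hy (le_of_not_ge h)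
    rwa [sub_sq_comm (y ^ q), sub_sq_comm y]
  have h1 := Real.rpow_add_le_add_rpow hz (sub_nonneg.2 h) hq0 hq1
  rw [add_sub_cancel] at h1
  have h2 : z ^ q ≤ y ^ q := Real.rpow_le_rpow hz h hq0
  calc (y ^ q - z ^ q) ^ 2 ≤ ((y - z) ^ q) ^ 2 := by
        apply pow_le_pow_left₀ <;> linarith
    _ = ((y - z) ^ 2) ^ q := by
        rw [← Real.rpow_natCast, ← Real.rpow_natCast, ← Real.rpow_mul (sub_nonneg.2 h),
          ← Real.rpow_mul (sub_nonneg.2 h), mul_comm]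

section

variable {V : Type*} [Fintype V] [DecidableEq V] {T : RootedTree V} {L : ℕ} {x : V → ℝ}
  {I : (V → ℝ) → V → ℕ} {τ γ : ℝ}

local notation "μV" => Measure.pi (fun _ : V => unif)

/-- Second moment of a power of the rounded total. -/
lemma IsTreeRounding.integral_rpow_le (h : IsTreeRounding T (grid τ γ) L x I) (hτ : 0 < τ)
    (hγ : 0 < γ) (hx : ∀ v, 0 ≤ x v) {z : ℝ} (hz : z = ∑ a, x a) {q : ℝ} (hq0 : 0 < q)
    (hq1 : q ≤ 1) :
    ∫ b, grid τ γ (I b T.root) ^ q ∂μV ≤ 2 * z ^ q := by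
  have hn := grid_nonneg hτ hγ
  have h1 := h.integral_le hτ hγ hx T.root
  rw [T.subtree_root, ← hz] at h1
  have hz0 : 0 ≤ z := hz ▸ Finset.sum_nonneg fun a _ => hx a
  rcases hz0.eq_or_lt with hz1 | hz1
  · have h2 : (fun b => grid τ γ (I b T.root)) =ᵐ[μV] 0 := by
      rw [← integral_eq_zero_iff_of_nonneg (fun b => hn _)
        (h.integrable_comp fun i => grid τ γ (i T.root))]
      exact le_antisymm (hz1 ▸ h1) (integral_nonneg fun b => hn _)
    have h3 : ∫ b, grid τ γ (I b T.root) ^ q ∂μV = 0 := by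
      refine integral_eq_zero_of_ae ?_
      filter_upwards [h2] with b hb
      simp only [Pi.zero_apply] at hb ⊢
      rw [hb, Real.zero_rpow hq0.ne']
    rw [h3]
    positivity
  · calc ∫ b, grid τ γ (I b T.root) ^ q ∂μV
        ≤ ∫ b, (z ^ q + z ^ (q - 1) * grid τ γ (I b T.root)) ∂μV :=
          integral_mono (h.integrable_comp fun i => grid τ γ (i T.root) ^ q)
            (h.integrable_comp fun i => z ^ q + z ^ (q - 1) * grid τ γ (i T.root))
            fun b => rpow_le_add_mul (hn _) hz1 hq0.le hq1
      _ = z ^ q + z ^ (q - 1) * ∫ b, grid τ γ (I b T.root) ∂μV := by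
          rw [integral_add (integrable_const _)
            (h.integrable_comp fun i => z ^ (q - 1) * grid τ γ (i T.root)), integral_const_mul]
          simp
      _ ≤ z ^ q + z ^ (q - 1) * z := by gcongr
      _ = 2 * z ^ q := by
          rw [← Real.rpow_add_one hz1.ne']; norm_num; ring

/-- Mean square error of a power of the rounded total. -/
lemma IsTreeRounding.integral_rpow_sub_sq_le (h : IsTreeRounding T (grid τ γ) L x I) (hτ : 0 < τ)
    (hτ1 : τ ≤ 1) (hγ : 0 < γ) (hγ1 : γ ≤ 1) (hx : ∀ v, 0 ≤ x v) (hL : 0 < L) {z : ℝ}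
    (hz : z = ∑ a, x a) {B : ℝ} (hB : 1 ≤ B) (hBL : 6 * Fintype.card V * B / γ ≤ grid τ γ L)
    {q r : ℝ} (hq0 : 0 < q) (hq1 : 2 * q ≤ 1) (hr : 0 < r) :
    ∫ b, (grid τ γ (I b T.root) ^ q - z ^ q) ^ 2 ∂μV ≤
      3 * γ * z ^ (2 * q) + 2 * (3 * τ ^ 2 / γ) ^ q + 3 * z ^ (2 * q + r) * B ^ (-r) := by
  have hn := grid_nonneg hτ hγ
  have hgL : 0 < grid τ γ L := grid_strictMono hτ hγ hL
  have hz0 : 0 ≤ z := hz ▸ Finset.sum_nonneg fun a _ => hx a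
  have t1 : 0 ≤ 3 * γ * z ^ (2 * q) := by positivity
  have t2 : 0 ≤ 2 * (3 * τ ^ 2 / γ) ^ q := by positivity
  have t3 : 0 ≤ 3 * z ^ (2 * q + r) * B ^ (-r) := by positivity
  have hq1' : q ≤ 1 := by linarith
  have hint := h.integrable_comp fun i => (grid τ γ (i T.root) ^ q - z ^ q) ^ 2
  have hint2 := h.integrable_comp fun i => (grid τ γ (i T.root) - z) ^ 2
  rcases le_or_gt z B with hzB | hzB
  · have hmse : ∫ b, (grid τ γ (I b T.root) - z) ^ 2 ∂μV ≤ 2 * γ * z ^ 2 + τ * z := by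
      refine (h.integral_sub_sq_le hτ hγ hx hL hz).trans ?_
      have h1 : Fintype.card V * (((1 + γ) * z ^ 2 + τ * z) / grid τ γ L) ≤ γ * z / 2 := by
        rw [← mul_div_assoc, div_le_iff₀ hgL]
        rw [div_le_iff₀ hγ] at hBL
        have h2 : (1 + γ) * z ^ 2 + τ * z ≤ z * (3 * B) := by
          nlinarith [mul_nonneg hz0 (sub_nonneg.2 hzB), mul_nonneg hz0 (sub_nonneg.2 hτ1),
            mul_nonneg hz0 (sub_nonneg.2 hB), mul_nonneg (mul_nonneg hz0 hz0) (sub_nonneg.2 hγ1)]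
        have h3 : (0 : ℝ) ≤ Fintype.card V := Nat.cast_nonneg _
        nlinarith [mul_le_mul_of_nonneg_left h2 h3, mul_le_mul_of_nonneg_left hBL hz0]
      nlinarith
    rcases le_or_gt τ (γ * z) with hτz | hτz
    · have hz1 : 0 < z := by
        by_contra hcon
        nlinarith
      have h1 : ∫ b, (grid τ γ (I b T.root) - z) ^ 2 ∂μV ≤ 3 * γ * z ^ 2 := by nlinarith
      have h2 : ∫ b, (grid τ γ (I b T.root) ^ q - z ^ q) ^ 2 ∂μV ≤
          z ^ (2 * q - 2) * ∫ b, (grid τ γ (I b T.root) - z) ^ 2 ∂μV := by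
        rw [← integral_const_mul]
        exact integral_mono hint (hint2.const_mul _)
          fun b => rpow_sub_rpow_sq_le (hn _) hz1 hq0.le hq1'
      have h3 : z ^ (2 * q - 2) * (3 * γ * z ^ 2) = 3 * γ * z ^ (2 * q) := by
        have : z ^ (2 * q) = z ^ (2 * q - 2) * z ^ 2 := by
          rw [← Real.rpow_natCast z, ← Real.rpow_add hz1]; congr 1; push_cast; ring
        rw [this]; ring
      have h4 := mul_le_mul_of_nonneg_left h1 (Real.rpow_nonneg hz0 (2 * q - 2))
      linarith
    · set s := 3 * τ ^ 2 / γ with hs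
      have hs0 : 0 < s := by positivity
      have h1 : ∫ b, (grid τ γ (I b T.root) - z) ^ 2 ∂μV ≤ s := by
        rw [hs, le_div_iff₀ hγ]
        nlinarith [mul_nonneg hγ.le hz0]
      have h2 : ∫ b, (grid τ γ (I b T.root) ^ q - z ^ q) ^ 2 ∂μV ≤
          ∫ b, (s ^ q + s ^ (q - 1) * (grid τ γ (I b T.root) - z) ^ 2) ∂μV :=
        integral_mono hint ((integrable_const _).add (hint2.const_mul _)) fun b =>
          (rpow_sub_rpow_sq_le_abs (hn _) hz0 hq0.le hq1').trans
            (rpow_le_add_mul (sq_nonneg _) hs0 hq0.le hq1')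
      rw [integral_add (integrable_const _) (hint2.const_mul _), integral_const_mul] at h2
      simp only [integral_const, probReal_univ, one_smul] at h2
      have h3 := mul_le_mul_of_nonneg_left h1 (Real.rpow_nonneg hs0.le (q - 1))
      rw [← Real.rpow_add_one hs0.ne', sub_add_cancel] at h3
      linarith
  · have hB0 : 0 < B := by linarith
    have hz1 : 0 < z := hB0.trans hzB
    have h1 : ∫ b, (grid τ γ (I b T.root) ^ q - z ^ q) ^ 2 ∂μV ≤
        ∫ b, (grid τ γ (I b T.root) ^ (2 * q) + z ^ (2 * q)) ∂μV := by
      refine integral_mono hint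
        (h.integrable_comp fun i => grid τ γ (i T.root) ^ (2 * q) + z ^ (2 * q)) fun b => ?_
      have e : ∀ y : ℝ, 0 ≤ y → y ^ (2 * q) = (y ^ q) ^ 2 := fun y hy => by
        rw [← Real.rpow_natCast, ← Real.rpow_mul hy, mul_comm]; norm_num
      simp only
      rw [e _ (hn _), e _ hz0]
      nlinarith [mul_nonneg (Real.rpow_nonneg (hn (I b T.root)) q) (Real.rpow_nonneg hz0 q)]
    rw [integral_add (h.integrable_comp fun i => grid τ γ (i T.root) ^ (2 * q))
      (integrable_const _)] at h1
    have h2 := h.integral_rpow_le hτ hγ hx hz (q := 2 * q) (by linarith) hq1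
    simp only [integral_const, probReal_univ, one_smul] at h1
    have h3 : z ^ (2 * q) ≤ z ^ (2 * q + r) * B ^ (-r) := by
      rw [Real.rpow_add hz1, mul_assoc]
      refine le_mul_of_one_le_right (by positivity) ?_
      rw [Real.rpow_neg hB0.le, ← div_eq_mul_inv, one_le_div (by positivity)]
      exact Real.rpow_le_rpow hB0.le hzB.le hr.le
    linarith

end

/-! ### Averages of independent copies -/

lemma le_measureReal_abs_mean_sub_le {Ω : Type*} [MeasurableSpace Ω] (ν : Measure Ω)
    [IsProbabilityMeasure ν] {h : Ω → ℝ} (hm : Measurable h) (hh : MemLp h 2 ν) {k : ℕ} (hk : 0 < k)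
    (t : ℝ) {ρ : ℝ} (hρ : 0 < ρ) :
    1 - ((∫ ω, h ω ^ 2 ∂ν) / k + (∫ ω, h ω ∂ν - t) ^ 2) / ρ ^ 2 ≤
      (Measure.pi fun _ : Fin k => ν).real {ω | |(∑ j, h (ω j)) / k - t| ≤ ρ} := by
  have hk' : (0 : ℝ) < k := Nat.cast_pos.2 hk
  set P := Measure.pi fun _ : Fin k => ν with hP
  set W : (Fin k → Ω) → ℝ := fun ω => (∑ j, h (ω j)) / k with hW
  have hWm : Measurable W := by fun_prop
  have hcomp : ∀ j, MemLp (fun ω : Fin k → Ω => h (ω j)) 2 P := fun j =>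
    hh.comp_measurePreserving (measurePreserving_eval _ j)
  have hsum : MemLp (fun ω : Fin k → Ω => ∑ j, h (ω j)) 2 P :=
    memLp_finsetSum _ fun j _ => hcomp j
  have hWL : MemLp W 2 P := by
    simpa [hW, div_eq_mul_inv, mul_comm] using hsum.const_mul (k : ℝ)⁻¹
  have hmean : ∫ ω, W ω ∂P = ∫ ω, h ω ∂ν := by
    simp only [hW]
    rw [integral_div, integral_finsetSum _ fun j _ => (hcomp j).integrable one_le_two]
    have : ∀ j : Fin k, ∫ ω, h (ω j) ∂P = ∫ ω, h ω ∂ν := fun j =>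
      integral_comp_eval (μ := fun _ : Fin k => ν) hm.aestronglyMeasurable
    simp only [this]
    simp [hk'.ne']
  have hvar : ProbabilityTheory.variance W P ≤ (∫ ω, h ω ^ 2 ∂ν) / k := by
    have e : W = fun ω => (k : ℝ)⁻¹ * (∑ j, fun ω : Fin k → Ω => h (ω j)) ω := by
      ext ω; simp [hW, div_eq_mul_inv, mul_comm]
    rw [e, ProbabilityTheory.variance_const_mul,
      ProbabilityTheory.variance_sum_pi (fun _ => hh)]
    have h1 : ProbabilityTheory.variance h ν ≤ ∫ ω, h ω ^ 2 ∂ν :=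
      ProbabilityTheory.variance_le_expectation_sq hh.aestronglyMeasurable
    simp only [Finset.sum_const, Finset.card_univ, Fintype.card_fin, nsmul_eq_mul]
    calc ((k : ℝ)⁻¹) ^ 2 * (k * ProbabilityTheory.variance h ν)
        = ProbabilityTheory.variance h ν / k := by field_simp
      _ ≤ _ := by gcongr
  have hsq : ∫ ω, (W ω - t) ^ 2 ∂P ≤ (∫ ω, h ω ^ 2 ∂ν) / k + (∫ ω, h ω ∂ν - t) ^ 2 := by
    have h1 := ProbabilityTheory.variance_eq_sub hWL
    have h2 : ∫ ω, (W ω - t) ^ 2 ∂P = ∫ ω, W ω ^ 2 ∂P - 2 * t * ∫ ω, W ω ∂P + t ^ 2 := by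
      have e : ∀ ω, (W ω - t) ^ 2 = (W ω ^ 2 - 2 * t * W ω) + t ^ 2 := fun ω => by ring
      have i1 := hWL.integrable_sq
      have i2 := (hWL.integrable one_le_two).const_mul (2 * t)
      have i3 : Integrable (fun ω => W ω ^ 2 - 2 * t * W ω) P := i1.sub i2
      simp only [e]
      rw [integral_add i3 (integrable_const _), integral_sub i1 i2, integral_const_mul]
      simp
    simp only [Pi.pow_apply] at h1
    rw [h2, hmean]
    rw [h1, hmean] at hvar
    linarith
  have hint : Integrable (fun ω => (W ω - t) ^ 2) P := (hWL.sub (memLp_const t)).integrable_sq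
  have hmark := mul_meas_ge_le_integral_of_nonneg (μ := P) (f := fun ω => (W ω - t) ^ 2)
    (Eventually.of_forall fun ω => sq_nonneg _) hint (ρ ^ 2)
  have hset : MeasurableSet {ω | |W ω - t| ≤ ρ} := measurableSet_le (by fun_prop) measurable_const
  have hcompl : P.real {ω | |W ω - t| ≤ ρ}ᶜ ≤ P.real {ω | ρ ^ 2 ≤ (W ω - t) ^ 2} := by
    refine measureReal_mono fun ω hω => ?_
    have : ρ < |W ω - t| := not_le.1 hω
    change ρ ^ 2 ≤ (W ω - t) ^ 2
    rw [← sq_abs (W ω - t)]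
    exact pow_le_pow_left₀ hρ.le this.le 2
  rw [probReal_compl_eq_one_sub hset] at hcompl
  have h5 : P.real {ω | ρ ^ 2 ≤ (W ω - t) ^ 2} ≤
      ((∫ ω, h ω ^ 2 ∂ν) / k + (∫ ω, h ω ∂ν - t) ^ 2) / ρ ^ 2 := by
    rw [le_div_iff₀ (by positivity), mul_comm]
    exact hmark.trans hsq
  linarith

end

section

open Filter

/-! ### Accuracy of the estimator -/

lemma sq_integral_le_integral_sq {Ω : Type*} [MeasurableSpace Ω] {ν : Measure Ω}
    [IsProbabilityMeasure ν] {f : Ω → ℝ} (hf : MemLp f 2 ν) :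
    (∫ ω, f ω ∂ν) ^ 2 ≤ ∫ ω, f ω ^ 2 ∂ν := by
  have h1 := ProbabilityTheory.variance_eq_sub hf
  have h2 := ProbabilityTheory.variance_nonneg f ν
  simp only [Pi.pow_apply] at h1
  linarith

lemma sketch_sum (p : ℝ) {n N m : ℕ} (a : Fin n × Fin N → ℝ) (X : Fin m → Fin n → ℕ) :
    sketch p N a (fun i => ∑ v, X v i) = ∑ v, sketch p N a (X v) := by
  simp only [sketch]
  rw [Finset.sum_comm]
  exact Finset.sum_congr rfl fun i _ => by rw [Nat.cast_sum, Finset.sum_mul]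

/-- The `q`-th power of one counter, as a function of its uniform random numbers. -/
def counterPow (p q : ℝ) {n N m : ℕ} (T : RootedTree (Fin m)) (g : ℕ → ℝ) (L : ℕ)
    (X : Fin m → Fin n → ℕ) (ω : (Fin n × Fin N → ℝ) × (Fin m → ℝ)) : ℝ :=
  g (treeIdx T g L (fun v => sketch p N ω.1 (X v)) ω.2 T.root) ^ q

section

variable {p q : ℝ} {n N m : ℕ} (T : RootedTree (Fin m)) (g : ℕ → ℝ) (L : ℕ)
  (X : Fin m → Fin n → ℕ)

lemma measurable_counterPow :
    Measurable (counterPow p q (N := N) T g L X) := by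
  have h1 : Measurable fun ω : (Fin n × Fin N → ℝ) × (Fin m → ℝ) =>
      ((fun v => sketch p N ω.1 (X v)), ω.2) :=
    (measurable_pi_lambda _ fun v => (measurable_sketch p (X v)).comp measurable_fst).prodMk
      measurable_snd
  exact ((measurable_of_countable fun i => g i ^ q).comp
    ((measurable_treeIdx T g L T.root).comp h1))

lemma memLp_counterPow (r : ENNReal) (μ : Measure ((Fin n × Fin N → ℝ) × (Fin m → ℝ)))
    [IsProbabilityMeasure μ] : MemLp (counterPow p q T g L X) r μ := by
  refine MemLp.of_bound (measurable_counterPow T g L X).aestronglyMeasurable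
    (∑ i ∈ Finset.range (L + 1), |g i ^ q|) (Eventually.of_forall fun ω => ?_)
  exact Finset.single_le_sum (f := fun i => |g i ^ q|) (fun i _ => abs_nonneg _)
    (Finset.mem_range.2 (Nat.lt_succ_of_le ((isTreeRounding_treeIdx T g L _).idx_le ω.2 T.root)))

end

section

variable {p q r : ℝ} {n N m L : ℕ} {T : RootedTree (Fin m)} {τ γ : ℝ} {X : Fin m → Fin n → ℕ}

local notation "μA" => Measure.pi (fun _ : Fin n × Fin N => unif)
local notation "μB" => Measure.pi (fun _ : Fin m => unif)

lemma rpow_two_mul_eq {y : ℝ} (hy : 0 ≤ y) (q : ℝ) : y ^ (2 * q) = (y ^ q) ^ 2 := by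
  rw [← Real.rpow_natCast, ← Real.rpow_mul hy, mul_comm]; norm_num

lemma integral_counterPow_sq_le (hτ : 0 < τ) (hγ : 0 < γ) (hq0 : 0 < q) (hq1 : 2 * q ≤ 1)
    (hi : Integrable (fun a => sketch p N a (fun i => ∑ v, X v i) ^ (2 * q)) μA) :
    ∫ ω, counterPow p q T (grid τ γ) L X ω ^ 2 ∂(Measure.prod μA μB) ≤
      2 * ∫ a, sketch p N a (fun i => ∑ v, X v i) ^ (2 * q) ∂μA := by
  have hn := grid_nonneg hτ hγ
  rw [integral_prod _ (memLp_counterPow T _ L X 2 _).integrable_sq, ← integral_const_mul]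
  refine integral_mono_of_nonneg (Eventually.of_forall fun a => integral_nonneg fun b => sq_nonneg _)
    (hi.const_mul 2) (Eventually.of_forall fun a => ?_)
  have h := (isTreeRounding_treeIdx T (grid τ γ) L fun v => sketch p N a (X v)).integral_rpow_le
    hτ hγ (fun v => sketch_nonneg p a (X v)) (sketch_sum p a X) (q := 2 * q) (by linarith) hq1
  simp only [rpow_two_mul_eq (hn _)] at h
  exact h

lemma integral_counterPow_sub_sq_le (hτ : 0 < τ) (hτ1 : τ ≤ 1) (hγ : 0 < γ) (hγ1 : γ ≤ 1)
    (hL : 0 < L) {B : ℝ} (hB : 1 ≤ B) (hBL : 6 * m * B / γ ≤ grid τ γ L)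
    (hq0 : 0 < q) (hq1 : 2 * q ≤ 1) (hr : 0 < r)
    (hi : Integrable (fun a => sketch p N a (fun i => ∑ v, X v i) ^ (2 * q)) μA)
    (hi' : Integrable (fun a => sketch p N a (fun i => ∑ v, X v i) ^ (2 * q + r)) μA) :
    (∫ ω, counterPow p q T (grid τ γ) L X ω ∂(Measure.prod μA μB) -
        ∫ a, sketch p N a (fun i => ∑ v, X v i) ^ q ∂μA) ^ 2 ≤
      3 * γ * ∫ a, sketch p N a (fun i => ∑ v, X v i) ^ (2 * q) ∂μA + 2 * (3 * τ ^ 2 / γ) ^ q +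
        3 * (∫ a, sketch p N a (fun i => ∑ v, X v i) ^ (2 * q + r) ∂μA) * B ^ (-r) := by
  have hn := grid_nonneg hτ hγ
  set z : (Fin n × Fin N → ℝ) → ℝ := fun a => sketch p N a (fun i => ∑ v, X v i) with hz
  have hz0 : ∀ a, 0 ≤ z a := fun a => sketch_nonneg p a _
  have hzm : Measurable z := measurable_sketch p _
  have hzL : MemLp (fun a => z a ^ q) 2 μA := by
    rw [memLp_two_iff_integrable_sq (hzm.pow_const q).aestronglyMeasurable]
    exact hi.congr (Eventually.of_forall fun a => rpow_two_mul_eq (hz0 a) q)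
  have hzL' : MemLp (fun ω : (Fin n × Fin N → ℝ) × (Fin m → ℝ) => z ω.1 ^ q) 2 (Measure.prod μA μB) :=
    hzL.comp_measurePreserving measurePreserving_fst
  have hc := memLp_counterPow (p := p) (q := q) (N := N) T (grid τ γ) L X 2 (Measure.prod μA μB)
  have e1 : ∫ a, z a ^ q ∂μA = ∫ ω, z ω.1 ^ q ∂(Measure.prod μA μB) := by
    rw [integral_prod _ (hzL'.integrable one_le_two)]
    simp
  rw [e1, ← integral_sub (hc.integrable one_le_two) (hzL'.integrable one_le_two)]
  have hsub := hc.sub hzL'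
  refine (sq_integral_le_integral_sq hsub).trans ?_
  rw [integral_prod _ hsub.integrable_sq]
  have hint : Integrable (fun a => 3 * γ * z a ^ (2 * q) + 2 * (3 * τ ^ 2 / γ) ^ q +
      3 * z a ^ (2 * q + r) * B ^ (-r)) μA :=
    ((hi.const_mul _).add (integrable_const _)).add ((hi'.const_mul 3).mul_const _)
  calc _ ≤ ∫ a, (3 * γ * z a ^ (2 * q) + 2 * (3 * τ ^ 2 / γ) ^ q +
      3 * z a ^ (2 * q + r) * B ^ (-r)) ∂μA := by
        refine integral_mono_of_nonneg
          (Eventually.of_forall fun a => integral_nonneg fun b => sq_nonneg _) hint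
          (Eventually.of_forall fun a => ?_)
        exact (isTreeRounding_treeIdx T (grid τ γ) L
          fun v => sketch p N a (X v)).integral_rpow_sub_sq_le hτ hτ1 hγ hγ1
          (fun v => sketch_nonneg p a (X v)) hL (sketch_sum p a X) hB
          (by simpa using hBL) hq0 hq1 hr
    _ = _ := by
        have i1 : Integrable (fun a => 3 * γ * z a ^ (2 * q)) μA := hi.const_mul _
        have i2 : Integrable (fun a => 3 * γ * z a ^ (2 * q) + 2 * (3 * τ ^ 2 / γ) ^ q) μA :=
          i1.add (integrable_const _)
        have i3 : Integrable (fun a => 3 * z a ^ (2 * q + r) * B ^ (-r)) μA :=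
          (hi'.const_mul 3).mul_const _
        rw [integral_add i2 i3, integral_add i1 (integrable_const _)]
        simp only [integral_mul_const, integral_const_mul, integral_const, probReal_univ, one_smul,
          hz]

end

lemma abs_cube_sub_le {y t F C ε : ℝ} (hC : 0 < C) (hF : 0 ≤ F) (hε : 0 < ε) (hε1 : ε < 1)
    (ht : t = C * F ^ (1 / 3 : ℝ)) (h : |y - t| ≤ ε / 7 * t) : |(y / C) ^ 3 - F| ≤ ε * F := by
  set f := F ^ (1 / 3 : ℝ) with hf
  have hf0 : 0 ≤ f := Real.rpow_nonneg hF _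
  have hf3 : F = f ^ 3 := by
    rw [hf, ← Real.rpow_natCast, ← Real.rpow_mul hF]; norm_num
  set w := y / C with hw
  have hy : y = C * w := by rw [hw]; field_simp
  have hwf : |w - f| ≤ ε / 7 * f := by
    rw [hy, ht, ← mul_sub, abs_mul, abs_of_pos hC] at h
    have : C * |w - f| ≤ C * (ε / 7 * f) := by linarith
    exact le_of_mul_le_mul_left this hC
  have hw2 : |w| ≤ 2 * f := by
    have : |w| ≤ |w - f| + |f| := by simpa using abs_add_le (w - f) f
    rw [abs_of_nonneg hf0] at this
    nlinarith
  have e : w ^ 3 - F = (w - f) * (w ^ 2 + w * f + f ^ 2) := by rw [hf3]; ring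
  have hbound : |w ^ 2 + w * f + f ^ 2| ≤ 7 * f ^ 2 := by
    obtain ⟨h1, h2⟩ := abs_le.1 hw2
    rw [abs_le]
    constructor <;> nlinarith [mul_nonneg hf0 (sub_nonneg.2 h2), sq_nonneg (w + f)]
  rw [e, abs_mul]
  calc |w - f| * |w ^ 2 + w * f + f ^ 2| ≤ (ε / 7 * f) * (7 * f ^ 2) := by gcongr
    _ = ε * F := by rw [hf3]; ring

/-- The estimator is accurate with probability at least `2 / 3`. -/
lemma two_thirds_le_measureReal {p : ℝ} (hp0 : 0 < p) (hp1 : p < 1) {n N m L k : ℕ}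
    {T : RootedTree (Fin m)} {τ γ B ε C₁ C₂ C₃ : ℝ} {X : Fin m → Fin n → ℕ}
    (hC₁ : 0 < C₁) (hC₃ : 0 < C₃)
    (hε : 0 < ε) (hε1 : ε < 1) (hτ : 0 < τ) (hτ1 : τ ≤ 1) (hγ : 0 < γ) (hγ1 : γ ≤ 1)
    (hL : 0 < L) (hB : 1 ≤ B) (hBL : 6 * m * B / γ ≤ grid τ γ L) {F : ℝ} (hF : 1 ≤ F)
    (h1 : |∫ a, sketch p N a (fun i => ∑ v, X v i) ^ (p / 3)
      ∂(Measure.pi fun _ : Fin n × Fin N => unif) - C₁ * F ^ (1 / 3 : ℝ)| ≤ ε * C₁ / 35)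
    (hi2 : Integrable (fun a => sketch p N a (fun i => ∑ v, X v i) ^ (2 * (p / 3)))
      (Measure.pi fun _ : Fin n × Fin N => unif))
    (h2 : ∫ a, sketch p N a (fun i => ∑ v, X v i) ^ (2 * (p / 3))
      ∂(Measure.pi fun _ : Fin n × Fin N => unif) ≤ C₂ * F ^ (2 / 3 : ℝ))
    (hi3 : Integrable (fun a => sketch p N a (fun i => ∑ v, X v i) ^ (2 * (p / 3) + p / 6))
      (Measure.pi fun _ : Fin n × Fin N => unif))
    (h3 : ∫ a, sketch p N a (fun i => ∑ v, X v i) ^ (2 * (p / 3) + p / 6)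
      ∂(Measure.pi fun _ : Fin n × Fin N => unif) ≤ C₃ * F ^ (5 / 6 : ℝ))
    (hγε : γ * (3 * C₂ + 2 + 3 * C₃) ≤ ε ^ 2 * C₁ ^ 2 / 1176)
    (hτγ : (3 * τ ^ 2 / γ) ^ (p / 3) ≤ γ)
    (hBF : F ^ (1 / 6 : ℝ) * B ^ (-(p / 6)) ≤ γ)
    (hk0 : 0 < k) (hk : 588 * C₂ ≤ k * (C₁ ^ 2 * ε ^ 2)) :
    2 / 3 ≤ (Measure.pi fun _ : Fin k => (Measure.pi fun _ : Fin n × Fin N => unif).prod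
      (Measure.pi fun _ : Fin m => unif)).real
        {ω | |((∑ j, counterPow p (p / 3) T (grid τ γ) L X (ω j)) / k / C₁) ^ 3 - F| ≤ ε * F} := by
  set ν := (Measure.pi fun _ : Fin n × Fin N => unif).prod (Measure.pi fun _ : Fin m => unif) with hν
  set h := counterPow p (p / 3) (N := N) T (grid τ γ) L X with hh
  set f := F ^ (1 / 3 : ℝ) with hf
  have hF0 : 0 < F := by linarith
  have hf1 : 1 ≤ f := Real.one_le_rpow hF (by norm_num)
  have hf2 : F ^ (2 / 3 : ℝ) = f ^ 2 := by
    rw [hf, ← Real.rpow_natCast, ← Real.rpow_mul hF0.le]; norm_num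
  have hk' : (0 : ℝ) < k := Nat.cast_pos.2 hk0
  have hρ : 0 < ε / 7 * (C₁ * f) := by positivity
  have key := le_measureReal_abs_mean_sub_le ν (measurable_counterPow T (grid τ γ) L X)
    (memLp_counterPow (p := p) (q := p / 3) T (grid τ γ) L X 2 ν) hk0 (C₁ * f) hρ
  have hsub : {ω : Fin k → _ | |(∑ j, h (ω j)) / k - C₁ * f| ≤ ε / 7 * (C₁ * f)} ⊆
      {ω | |((∑ j, h (ω j)) / k / C₁) ^ 3 - F| ≤ ε * F} := fun ω hω =>
    abs_cube_sub_le hC₁ hF0.le hε hε1 rfl hω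
  refine le_trans ?_ (key.trans (measureReal_mono hsub))
  have m2 := integral_counterPow_sq_le (T := T) (L := L) (X := X) hτ hγ (by positivity : 0 < p / 3)
    (by linarith) hi2
  have mb := integral_counterPow_sub_sq_le (T := T) (r := p / 6) hτ hτ1 hγ hγ1 hL hB hBL
    (by positivity : 0 < p / 3) (by linarith) (by positivity) hi2 hi3
  rw [hf2] at h2
  have hf4 : 1 ≤ f ^ 2 := one_le_pow₀ hf1
  have hvar : (∫ ω, h ω ^ 2 ∂ν) / k ≤ (ε / 7 * (C₁ * f)) ^ 2 / 6 := by
    have : ∫ ω, h ω ^ 2 ∂ν ≤ 2 * (C₂ * f ^ 2) := m2.trans (by linarith)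
    rw [div_le_iff₀ hk']
    have := mul_le_mul_of_nonneg_right hk (sq_nonneg f)
    linarith
  have hE : 3 * γ * (C₂ * f ^ 2) + 2 * γ + 3 * C₃ * (γ * f ^ 2) ≤ (ε / 7 * (C₁ * f)) ^ 2 / 24 := by
    have e1 : 2 * γ ≤ 2 * γ * f ^ 2 := le_mul_of_one_le_right (by positivity) hf4
    have e2 := mul_le_mul_of_nonneg_right hγε (sq_nonneg f)
    linarith
  have h56 : F ^ (5 / 6 : ℝ) * B ^ (-(p / 6)) ≤ γ * f ^ 2 := by
    have : F ^ (5 / 6 : ℝ) = f ^ 2 * F ^ (1 / 6 : ℝ) := by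
      rw [← hf2, ← Real.rpow_add hF0]; norm_num
    rw [this, mul_assoc, mul_comm γ]
    gcongr
  have hB0 : 0 ≤ B ^ (-(p / 6)) := Real.rpow_nonneg (by linarith) _
  have hb2 : (∫ ω, h ω ∂ν - ∫ a, sketch p N a (fun i => ∑ v, X v i) ^ (p / 3)
      ∂(Measure.pi fun _ : Fin n × Fin N => unif)) ^ 2 ≤ (ε / 7 * (C₁ * f)) ^ 2 / 24 := by
    refine (mb.trans ?_).trans hE
    have e1 := mul_le_mul_of_nonneg_left h2 (by positivity : 0 ≤ 3 * γ)
    have e2 := mul_le_mul_of_nonneg_right (mul_le_mul_of_nonneg_left h3 zero_le_three) hB0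
    have e3 := mul_le_mul_of_nonneg_left h56 (by positivity : 0 ≤ 3 * C₃)
    linarith
  have hη : (∫ a, sketch p N a (fun i => ∑ v, X v i) ^ (p / 3)
      ∂(Measure.pi fun _ : Fin n × Fin N => unif) - C₁ * f) ^ 2 ≤
        (ε / 7 * (C₁ * f)) ^ 2 / 24 := by
    have e1 := sq_le_sq' (abs_le.1 h1).1 (abs_le.1 h1).2
    have e2 : (ε * C₁) ^ 2 ≤ (ε * C₁) ^ 2 * f ^ 2 := le_mul_of_one_le_right (sq_nonneg _) hf4
    have e3 : 0 ≤ (ε * C₁) ^ 2 := sq_nonneg _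
    linarith
  have hbias : (∫ ω, h ω ∂ν - C₁ * f) ^ 2 ≤ (ε / 7 * (C₁ * f)) ^ 2 / 6 := by
    set u := ∫ a, sketch p N a (fun i => ∑ v, X v i) ^ (p / 3)
      ∂(Measure.pi fun _ : Fin n × Fin N => unif)
    have := sq_nonneg ((∫ ω, h ω ∂ν - u) - (u - C₁ * f))
    linarith
  have hfin : ((∫ ω, h ω ^ 2 ∂ν) / k + (∫ ω, h ω ∂ν - C₁ * f) ^ 2) / (ε / 7 * (C₁ * f)) ^ 2 ≤
      1 / 3 := by
    rw [div_le_iff₀ (by positivity)]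
    linarith
  linarith

end

section

open Filter Topology

/-! ### Choice of the parameters -/

/-- For bounded vectors the moments of the sketch approximate those of the stable law. -/
lemma exists_sketch {p : ℝ} (hp0 : 0 < p) (hp1 : p < 1) :
    ∃ C₁ C₂ C₃ : ℝ, 0 < C₁ ∧ 0 < C₂ ∧ 0 < C₃ ∧ ∀ (n bd : ℕ) (η : ℝ), 0 < η →
      ∃ N : ℕ, ∀ x : Fin n → ℕ, (∀ i, x i ≤ bd) →
        |∫ a, sketch p N a x ^ (p / 3) ∂(Measure.pi fun _ : Fin n × Fin N => unif) -
          C₁ * (∑ i, (x i : ℝ) ^ p) ^ (1 / 3 : ℝ)| ≤ η ∧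
        Integrable (fun a => sketch p N a x ^ (2 * (p / 3)))
          (Measure.pi fun _ : Fin n × Fin N => unif) ∧
        ∫ a, sketch p N a x ^ (2 * (p / 3)) ∂(Measure.pi fun _ : Fin n × Fin N => unif) ≤
          C₂ * (∑ i, (x i : ℝ) ^ p) ^ (2 / 3 : ℝ) ∧
        Integrable (fun a => sketch p N a x ^ (2 * (p / 3) + p / 6))
          (Measure.pi fun _ : Fin n × Fin N => unif) ∧
        ∫ a, sketch p N a x ^ (2 * (p / 3) + p / 6)
          ∂(Measure.pi fun _ : Fin n × Fin N => unif) ≤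
            C₃ * (∑ i, (x i : ℝ) ^ p) ^ (5 / 6 : ℝ) := by
  obtain ⟨C₁, hC₁, h1⟩ := exists_tendsto_integral_sketch_rpow hp0 hp1 (q := p / 3)
    (by linarith) (by linarith)
  obtain ⟨C₂, hC₂, h2⟩ := exists_integral_sketch_rpow_le hp0 hp1 (q := 2 * (p / 3))
    (by linarith) (by linarith)
  obtain ⟨C₃, hC₃, h3⟩ := exists_integral_sketch_rpow_le hp0 hp1 (q := 2 * (p / 3) + p / 6)
    (by linarith) (by linarith)
  rw [show p / 3 / p = 1 / 3 by field_simp] at h1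
  rw [show 2 * (p / 3) / p = 2 / 3 by field_simp] at h2
  rw [show (2 * (p / 3) + p / 6) / p = 5 / 6 by field_simp; norm_num] at h3
  refine ⟨C₁, C₂, C₃, hC₁, hC₂, hC₃, fun n bd η hη => ?_⟩
  have hev : ∀ᶠ N : ℕ in atTop, ∀ x ∈ Set.Icc (0 : Fin n → ℕ) (fun _ => bd),
      |∫ a, sketch p N a x ^ (p / 3) ∂(Measure.pi fun _ : Fin n × Fin N => unif) -
        C₁ * (∑ i, (x i : ℝ) ^ p) ^ (1 / 3 : ℝ)| ≤ η := by
    rw [eventually_all_finite (Set.finite_Icc _ _)]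
    intro x _
    have := (h1 x).eventually (Metric.closedBall_mem_nhds _ hη)
    filter_upwards [this] with N hN
    rwa [← Real.dist_eq]
  obtain ⟨N, hN, hN0⟩ := (hev.and (eventually_gt_atTop 0)).exists
  refine ⟨N, fun x hx => ⟨hN x ⟨fun i => Nat.zero_le _, hx⟩, (h2 hN0 x).1, (h2 hN0 x).2,
    (h3 hN0 x).1, (h3 hN0 x).2⟩⟩

lemma half_le_log_one_add {γ : ℝ} (hγ : 0 < γ) (hγ1 : γ ≤ 1) : γ / 2 ≤ Real.log (1 + γ) := by
  refine le_trans ?_ (Real.one_sub_inv_le_log_of_pos (by linarith))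
  have : 1 - (1 + γ)⁻¹ = γ / (1 + γ) := by field_simp; ring
  rw [this]
  exact div_le_div_of_nonneg_left hγ.le (by linarith) (by linarith)

/-- A grid with `2 ^ b` points, where `b` is doubly logarithmic, covers the necessary range. -/
lemma exists_bits {p c : ℝ} (hp0 : 0 < p) (hc : 0 < c) (hc1 : c ≤ 1) :
    ∃ K : ℝ, 0 < K ∧ ∀ (Q m : ℕ) (ε : ℝ), 0 < Q → 0 < m → m ≤ Q → 0 < ε → ε < 1 →
      ∃ b : ℕ, 2 ≤ 2 ^ b ∧
        6 * m * ((Q : ℝ) * (c * ε ^ 2) ^ (-6 : ℝ)) ^ p⁻¹ / (c * ε ^ 2) ≤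
          grid ((c * ε ^ 2) ^ (1 + 3 / p)) (c * ε ^ 2) (2 ^ b - 1) ∧
        (b : ℝ) ≤ K * (Real.logb 2 (Real.logb 2 Q) + Real.logb 2 (2 / ε)) := by
  set H := (12 + 20 / p) / c ^ 2 with hH
  have hH0 : 0 < H := by positivity
  refine ⟨5 + |Real.logb 2 H|, by positivity, fun Q m ε hQ hm hmQ hε hε1 => ?_⟩
  set γ := c * ε ^ 2 with hγ
  have hγ0 : 0 < γ := by positivity
  have hγ1 : γ ≤ 1 := by nlinarith
  set Z := max 1 (Real.logb 2 Q) with hZ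
  have hZ1 : 1 ≤ Z := le_max_left _ _
  have hQ1 : (1 : ℝ) ≤ Q := by exact_mod_cast hQ
  have hQ0 : (0 : ℝ) < Q := by linarith
  have hm0 : (0 : ℝ) < m := by exact_mod_cast hm
  have hlogZ : Real.logb 2 Z = Real.logb 2 (Real.logb 2 Q) := by
    rcases Nat.lt_or_ge Q 2 with h | h
    · have : Q = 1 := by omega
      simp [hZ, this]
    · have : 1 ≤ Real.logb 2 Q := by
        rw [Real.le_logb_iff_rpow_le one_lt_two hQ0, Real.rpow_one]
        exact_mod_cast h
      rw [hZ, max_eq_right this]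
  set D := 2 * (5 + 10 / p) * Z / γ ^ 2 + 2 with hD
  have hD2 : 2 ≤ D := by
    have : 0 ≤ 2 * (5 + 10 / p) * Z / γ ^ 2 := by positivity
    linarith
  set b := ⌈Real.logb 2 D⌉₊ with hb
  have hbD : D ≤ (2 : ℝ) ^ b := by
    rw [← Real.rpow_natCast, ← Real.logb_le_iff_le_rpow one_lt_two (by linarith)]
    exact Nat.le_ceil _
  have h2b : 2 ≤ 2 ^ b := by exact_mod_cast hD2.trans hbD
  refine ⟨b, h2b, ?_, ?_⟩
  · obtain ⟨j, hj⟩ : ∃ j, 2 ^ b = j + 2 := ⟨2 ^ b - 2, by omega⟩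
    have hjD : 2 * (5 + 10 / p) * Z / γ ^ 2 ≤ j := by
      have : (2 : ℝ) ^ b = j + 2 := by exact_mod_cast hj
      linarith
    rw [hj, show j + 2 - 1 = j + 1 by omega, grid_succ]
    clear_value γ
    rw [← Real.log_le_log_iff (by positivity) (by positivity)]
    rw [Real.log_div (by positivity) hγ0.ne', Real.log_mul (by positivity) (by positivity),
      Real.log_mul (by norm_num) hm0.ne', Real.log_rpow (by positivity),
      Real.log_mul hQ0.ne' (by positivity), Real.log_rpow hγ0, Real.log_mul (by positivity)
      (by positivity), Real.log_rpow hγ0, Real.log_pow]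
    have l1 := half_le_log_one_add hγ0 hγ1
    have l2 : -Real.log γ ≤ γ⁻¹ := by
      rw [← Real.log_inv]
      linarith [Real.log_le_sub_one_of_pos (inv_pos.2 hγ0)]
    have l3 : Real.log m ≤ Real.log Q := Real.log_le_log hm0 (by exact_mod_cast hmQ)
    have l4 : Real.log Q ≤ Z := by
      refine le_trans ?_ (le_max_right _ _)
      rw [Real.logb, le_div_iff₀ (Real.log_pos one_lt_two)]
      have := Real.log_two_lt_d9
      nlinarith [Real.log_nonneg hQ1]
    have l5 : Real.log 6 ≤ 2 := by
      rw [Real.log_le_iff_le_exp (by norm_num)]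
      have := Real.exp_one_gt_d9
      have e : Real.exp 2 = Real.exp 1 * Real.exp 1 := by rw [← Real.exp_add]; norm_num
      rw [e]
      nlinarith
    have hg1 : 1 ≤ γ⁻¹ := (one_le_inv₀ hγ0).2 hγ1
    have l6 : Z ≤ Z * γ⁻¹ := le_mul_of_one_le_right (by linarith) hg1
    have l7 : γ⁻¹ ≤ Z * γ⁻¹ := le_mul_of_one_le_left (by linarith) hZ1
    have l8 : (5 + 10 / p) * (Z * γ⁻¹) ≤ j * (γ / 2) := by
      have := mul_le_mul_of_nonneg_right hjD (by positivity : 0 ≤ γ / 2)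
      have e : 2 * (5 + 10 / p) * Z / γ ^ 2 * (γ / 2) = (5 + 10 / p) * (Z * γ⁻¹) := by
        field_simp
      linarith
    have l9 : (j : ℝ) * (γ / 2) ≤ j * Real.log (1 + γ) :=
      mul_le_mul_of_nonneg_left l1 (Nat.cast_nonneg j)
    have hp' : 0 < p⁻¹ := inv_pos.2 hp0
    set Y := Z * γ⁻¹
    set lg := -Real.log γ with hlg'
    have hlg : Real.log γ = -lg := by rw [hlg']; ring
    rw [hlg]
    have q1 : p⁻¹ * Real.log Q ≤ p⁻¹ * Y := mul_le_mul_of_nonneg_left (l4.trans l6) hp'.le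
    have q2 : p⁻¹ * lg ≤ p⁻¹ * Y := mul_le_mul_of_nonneg_left (l2.trans l7) hp'.le
    have q3 : 10 / p = 10 * p⁻¹ := div_eq_mul_inv _ _
    have q4 : 3 / p = 3 * p⁻¹ := div_eq_mul_inv _ _
    rw [q3] at l8
    rw [q4]
    linarith
  · have hb1 : (b : ℝ) ≤ Real.logb 2 D + 1 :=
      (Nat.ceil_lt_add_one (Real.logb_nonneg one_lt_two (by linarith))).le
    have hDH : D ≤ H * Z * (1 / ε) ^ 4 := by
      have e1 : H * Z * (1 / ε) ^ 4 = (12 + 20 / p) * Z / γ ^ 2 := by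
        rw [hH, hγ]; field_simp
      have e2 : 1 ≤ Z / γ ^ 2 := by
        rw [le_div_iff₀ (by positivity), one_mul]
        exact (pow_le_one₀ hγ0.le hγ1).trans hZ1
      rw [e1, hD]
      have e3 : (12 + 20 / p) * Z / γ ^ 2 = 2 * (5 + 10 / p) * Z / γ ^ 2 + 2 * (Z / γ ^ 2) := by
        field_simp; ring
      linarith
    have hε1' : 1 ≤ 1 / ε := (one_le_div hε).2 hε1.le
    have hlogD : Real.logb 2 D ≤ Real.logb 2 H + Real.logb 2 Z + 4 * Real.logb 2 (1 / ε) := by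
      refine (Real.logb_le_logb_of_le one_lt_two (by linarith) hDH).trans ?_
      rw [Real.logb_mul (by positivity) (by positivity), Real.logb_mul (by positivity)
        (by positivity), Real.logb_pow]
      norm_num
    have hl : Real.logb 2 (2 / ε) = 1 + Real.logb 2 (1 / ε) := by
      rw [show 2 / ε = 2 * (1 / ε) by ring, Real.logb_mul two_ne_zero (by positivity),
        Real.logb_self_eq_one one_lt_two]
    have hl0 : 0 ≤ Real.logb 2 (1 / ε) := Real.logb_nonneg one_lt_two hε1'
    have hz0 : 0 ≤ Real.logb 2 Z := Real.logb_nonneg one_lt_two hZ1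
    rw [← hlogZ, hl]
    have ha := le_abs_self (Real.logb 2 H)
    have ha0 := abs_nonneg (Real.logb 2 H)
    nlinarith [mul_nonneg ha0 hl0, mul_nonneg ha0 hz0]

lemma rpow_scale_le {p γ : ℝ} (hp0 : 0 < p) (hγ : 0 < γ) (hγ1 : γ ≤ 1 / 3) :
    (3 * (γ ^ (1 + 3 / p)) ^ 2 / γ) ^ (p / 3) ≤ γ := by
  have e : (γ ^ (1 + 3 / p)) ^ 2 = γ ^ (2 : ℕ) * γ ^ (3 / p) * γ ^ (3 / p) := by
    rw [Real.rpow_add hγ, Real.rpow_one]; ring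
  have h1 : 3 * (γ ^ (1 + 3 / p)) ^ 2 / γ ≤ γ ^ (3 / p) := by
    rw [e, div_le_iff₀ hγ]
    have h2 : γ ^ (3 / p) ≤ 1 := Real.rpow_le_one hγ.le (by linarith) (by positivity)
    have h3 : 0 < γ ^ (3 / p) := by positivity
    have h4 : γ ^ (3 / p) * γ ^ (3 / p) ≤ γ ^ (3 / p) := mul_le_of_le_one_right h3.le h2
    have h5 : 3 * γ ^ 2 ≤ γ := by nlinarith
    calc 3 * (γ ^ 2 * γ ^ (3 / p) * γ ^ (3 / p)) = 3 * γ ^ 2 * (γ ^ (3 / p) * γ ^ (3 / p)) := by ring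
      _ ≤ γ * γ ^ (3 / p) := by gcongr
      _ = _ := mul_comm _ _
  calc _ ≤ (γ ^ (3 / p)) ^ (p / 3) := Real.rpow_le_rpow (by positivity) h1 (by positivity)
    _ = γ := by
      rw [← Real.rpow_mul hγ.le, show 3 / p * (p / 3) = 1 by field_simp, Real.rpow_one]

lemma rpow_cutoff_le {p γ F Q : ℝ} (hp0 : 0 < p) (hγ : 0 < γ) (hF : 1 ≤ F) (hFQ : F ≤ Q) :
    F ^ (1 / 6 : ℝ) * ((Q * γ ^ (-6 : ℝ)) ^ p⁻¹) ^ (-(p / 6)) ≤ γ := by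
  have hQ : 0 < Q := by linarith
  have e : ((Q * γ ^ (-6 : ℝ)) ^ p⁻¹) ^ (-(p / 6)) = (Q ^ (1 / 6 : ℝ))⁻¹ * γ := by
    rw [← Real.rpow_mul (by positivity), show p⁻¹ * (-(p / 6)) = -(1 / 6) by field_simp,
      Real.mul_rpow hQ.le (by positivity), Real.rpow_neg hQ.le, ← Real.rpow_mul hγ.le]
    norm_num
  rw [e, ← mul_assoc]
  refine mul_le_of_le_one_left hγ.le ?_
  rw [← div_eq_mul_inv, div_le_one (by positivity)]
  exact Real.rpow_le_rpow (by linarith) hFQ (by norm_num)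

end

end MessagePassing

end

open MessagePassing in
theorem theorem4p5 (p : ℝ) (hp0 : 0 < p) (hp1 : p < 1) :
    ∃ K : ℝ, 0 < K ∧
      ∀ (n m M : ℕ), 0 < n → 0 < M →
      ∀ ε : ℝ, 0 < ε → ε < 1 →
      ∀ G : SimpleGraph (Fin m), G.Connected →
      ∃ P : Protocol G n M,
        P.rounds ≤ G.diam ∧
        P.IsOneShot ∧
        ∀ X : Fin m → Input n M,
          (2 / 3 : ℝ) ≤
            fairCoins.real {ω | |P.result X ω - frequencyMoment p X| ≤ ε * frequencyMoment p X} ∧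
          ∀ ω : Coins,
            (P.maxCommunication X ω : ℝ) ≤
              K * (1 / ε ^ 2 *
                (Real.logb 2 (Real.logb 2 ((n : ℝ) * m * M)) + Real.logb 2 (2 / ε))) ∧
            (P.totalCommunication X ω : ℝ) ≤
              K * (m / ε ^ 2 *
                (Real.logb 2 (Real.logb 2 ((n : ℝ) * m * M)) + Real.logb 2 (2 / ε))) := by
  obtain ⟨C₁, C₂, C₃, hC₁, hC₂, hC₃, hsketch⟩ := exists_sketch hp0 hp1
  set c := min (1 / 3) (C₁ ^ 2 / (1176 * (3 * C₂ + 2 + 3 * C₃))) with hc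
  have hc0 : 0 < c := lt_min (by norm_num) (by positivity)
  have hc3 : c ≤ 1 / 3 := min_le_left _ _
  obtain ⟨K₀, hK₀, hbits⟩ := exists_bits hp0 hc0 (hc3.trans (by norm_num))
  set κ := 588 * C₂ / C₁ ^ 2 with hκ
  have hκ0 : 0 < κ := by positivity
  refine ⟨2 * (κ + 1) * K₀, by positivity, fun n m M hn hM ε hε hε1 G hG => ?_⟩
  have hm : 0 < m := Fin.pos_iff_nonempty.2 hG.nonempty
  have : Nonempty (Fin m) := hG.nonempty
  set γ := c * ε ^ 2 with hγ
  have hε2 : ε ^ 2 ≤ 1 := pow_le_one₀ hε.le hε1.le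
  have hγ0 : 0 < γ := by positivity
  have hγ3 : γ ≤ 1 / 3 := (mul_le_of_le_one_right hc0.le hε2).trans hc3
  set τ := γ ^ (1 + 3 / p) with hτ
  have hτ0 : 0 < τ := by positivity
  have hτ1 : τ ≤ 1 := Real.rpow_le_one hγ0.le (by linarith) (by positivity)
  have hQ : 0 < n * m * M := by positivity
  have hmQ : m ≤ n * m * M := by
    calc m = 1 * m * 1 := by ring
      _ ≤ n * m * M := by gcongr <;> omega
  obtain ⟨b, hb2, hbL, hbK⟩ := hbits (n * m * M) m ε hQ hm hmQ hε hε1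
  set B := (((n * m * M : ℕ) : ℝ) * γ ^ (-6 : ℝ)) ^ p⁻¹ with hB
  have hQ1 : (1 : ℝ) ≤ ((n * m * M : ℕ) : ℝ) := by exact_mod_cast hQ
  have hB1 : 1 ≤ B := by
    refine Real.one_le_rpow (one_le_mul_of_one_le_of_one_le hQ1 ?_) (by positivity)
    exact Real.one_le_rpow_of_pos_of_le_one_of_nonpos hγ0 (by linarith) (by norm_num)
  set k := ⌈κ / ε ^ 2⌉₊ with hk
  have hk0 : 0 < k := Nat.ceil_pos.2 (by positivity)
  have hk1 : κ / ε ^ 2 ≤ k := Nat.le_ceil _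
  have hk2 : (k : ℝ) ≤ (κ + 1) / ε ^ 2 := by
    have h1 : (k : ℝ) ≤ κ / ε ^ 2 + 1 := (Nat.ceil_lt_add_one (by positivity)).le
    have h2 : 1 ≤ 1 / ε ^ 2 := (one_le_div (by positivity)).2 hε2
    rw [add_div]
    linarith
  obtain ⟨N, hN⟩ := hsketch n (m * M) (ε * C₁ / 35) (by positivity)
  have : Nonempty (Fin k) := Fin.pos_iff_nonempty.1 hk0
  obtain ⟨f, hf, hfm⟩ := exists_uniforms (Fin k) (Fin n × Fin N) (Fin m)
  obtain ⟨T, hTadj, hTdepth⟩ := exists_bfs_tree hG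
  have hL1 : 2 ^ b - 1 + 1 = 2 ^ b := by omega
  obtain ⟨enc, dec, hlen, hdec⟩ := exists_encoding (k := k) (A := 2 ^ b - 1 + 1) (ℓ := b * k)
    (by rw [hL1, pow_mul])
  let A : TreeProtocolData G n M :=
    { k := k
      L := 2 ^ b - 1
      len := b * k
      g := grid τ γ
      tree := T
      adj_parent := hTadj
      coef := fun ω j i => sketchCoeff p N (f ω j).1 i
      measurable_coef := fun j i => (measurable_sketchCoeff p i).comp
        (measurable_fst.comp ((measurable_pi_apply j).comp hf))
      rnd := fun ω j v => (f ω j).2 v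
      measurable_rnd := fun j v => (measurable_pi_apply v).comp
        (measurable_snd.comp ((measurable_pi_apply j).comp hf))
      enc := enc
      dec := dec
      length_enc := hlen
      dec_enc := hdec
      est := fun i => ((∑ j, grid τ γ (i j) ^ (p / 3)) / k / C₁) ^ 3 }
  have hlenK : ((b * k : ℕ) : ℝ) ≤ (κ + 1) * K₀ * (1 / ε ^ 2 *
      (Real.logb 2 (Real.logb 2 ((n : ℝ) * m * M)) + Real.logb 2 (2 / ε))) := by
    push_cast at hbK ⊢
    have hb0 : (0 : ℝ) ≤ b := Nat.cast_nonneg b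
    calc (b : ℝ) * k ≤ (K₀ * (Real.logb 2 (Real.logb 2 ((n : ℝ) * m * M)) +
          Real.logb 2 (2 / ε))) * ((κ + 1) / ε ^ 2) := by gcongr; exact hb0.trans hbK
      _ = _ := by ring
  refine ⟨A.protocol, hTdepth, A.isOneShot, fun X => ⟨?_, fun ω => ⟨?_, ?_⟩⟩⟩
  · let Y : Fin m → Fin n → ℕ := fun v i => (X v i : ℕ)
    have hYle : ∀ i, ∑ v, Y v i ≤ m * M := fun i => by
      calc ∑ v, Y v i ≤ ∑ _v : Fin m, M := Finset.sum_le_sum fun v _ => Nat.lt_succ_iff.1 (X v i).2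
        _ = m * M := by simp
    have hres : ∀ ω, A.protocol.result X ω =
        ((∑ j, counterPow p (p / 3) T (grid τ γ) (2 ^ b - 1) Y (f ω j)) / k / C₁) ^ 3 := fun ω =>
      A.result_eq X ω
    have hFdef : frequencyMoment p X = ∑ i, ((∑ v, Y v i : ℕ) : ℝ) ^ p := rfl
    simp only [hres]
    rw [hFdef]
    set F := ∑ i, ((∑ v, Y v i : ℕ) : ℝ) ^ p with hF
    by_cases hzero : ∀ v i, Y v i = 0
    · have hF0 : F = 0 := by simp [hF, hzero, Real.zero_rpow hp0.ne']
      have hc0 : ∀ ω, counterPow p (p / 3) (N := N) T (grid τ γ) (2 ^ b - 1) Y ω = 0 := fun ω => by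
        have h1 : (fun v => sketch p N ω.1 (Y v)) = fun _ => 0 := by
          ext v; simp [sketch, hzero]
        rw [counterPow, h1, treeIdx_zero T (grid_strictMono hτ0 hγ0).monotone rfl, grid_zero,
          Real.zero_rpow (by positivity)]
      simp only [hF0, hc0]
      norm_num
    · push Not at hzero
      obtain ⟨v₀, i₀, hv₀⟩ := hzero
      have hF1 : 1 ≤ F := by
        have h1 : 1 ≤ ∑ v, Y v i₀ := (Nat.one_le_iff_ne_zero.2 hv₀).trans
          (Finset.single_le_sum (f := fun v => Y v i₀) (fun v _ => Nat.zero_le _)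
            (Finset.mem_univ v₀))
        have h2 : (1 : ℝ) ≤ ((∑ v, Y v i₀ : ℕ) : ℝ) ^ p :=
          Real.one_le_rpow (by exact_mod_cast h1) hp0.le
        exact h2.trans (Finset.single_le_sum (f := fun i => ((∑ v, Y v i : ℕ) : ℝ) ^ p)
          (fun i _ => by positivity) (Finset.mem_univ i₀))
      have hFQ : F ≤ ((n * m * M : ℕ) : ℝ) := by
        calc F ≤ ∑ _i : Fin n, ((m * M : ℕ) : ℝ) := Finset.sum_le_sum fun i _ => by
              rcases Nat.eq_zero_or_pos (∑ v, Y v i) with h0 | h0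
              · rw [h0, Nat.cast_zero, Real.zero_rpow hp0.ne']
                positivity
              · have h1 : (1 : ℝ) ≤ ((∑ v, Y v i : ℕ) : ℝ) := by exact_mod_cast h0
                have h2 := Real.rpow_le_rpow_of_exponent_le h1 hp1.le
                rw [Real.rpow_one] at h2
                exact h2.trans (by exact_mod_cast hYle i)
          _ = ((n * m * M : ℕ) : ℝ) := by simp [mul_assoc]
      obtain ⟨s1, s2, s3, s4, s5⟩ := hN (fun i => ∑ v, Y v i) hYle
      have hγε : γ * (3 * C₂ + 2 + 3 * C₃) ≤ ε ^ 2 * C₁ ^ 2 / 1176 := by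
        have h1 : c ≤ C₁ ^ 2 / (1176 * (3 * C₂ + 2 + 3 * C₃)) := min_le_right _ _
        rw [le_div_iff₀ (by positivity)] at h1
        rw [hγ, le_div_iff₀ (by norm_num)]
        nlinarith [mul_le_mul_of_nonneg_left h1 (sq_nonneg ε)]
      have hkε : 588 * C₂ ≤ k * (C₁ ^ 2 * ε ^ 2) := by
        rw [hκ, div_div, div_le_iff₀ (by positivity)] at hk1
        exact hk1
      have key := two_thirds_le_measureReal (T := T) (X := Y) (k := k) hp0 hp1 hC₁ hC₃ hε hε1 hτ0
        hτ1 hγ0 (by linarith) (by omega : 0 < 2 ^ b - 1) hB1 hbL hF1 s1 s2 s3 s4 s5 hγε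
        (rpow_scale_le hp0 hγ0 hγ3) (rpow_cutoff_le hp0 hγ0 hF1 hFQ) hk0 hkε
      rw [← hfm] at key
      refine key.trans (le_of_eq ?_)
      rw [measureReal_def, measureReal_def, Measure.map_apply hf]
      · rfl
      · refine measurableSet_le ?_ measurable_const
        have := measurable_counterPow (p := p) (q := p / 3) (N := N) T (grid τ γ) (2 ^ b - 1) Y
        fun_prop
  · have h1 : (A.protocol.maxCommunication X ω : ℝ) ≤ 2 * ((b * k : ℕ) : ℝ) := by
      exact_mod_cast A.maxCommunication_le X ω
    linarith
  · have h1 : (A.protocol.totalCommunication X ω : ℝ) ≤ m * ((b * k : ℕ) : ℝ) := by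
      exact_mod_cast A.totalCommunication_le X ω
    have hm0 : (0 : ℝ) ≤ m := Nat.cast_nonneg m
    have h2 := mul_le_mul_of_nonneg_left hlenK hm0
    have h3 : (0 : ℝ) ≤ m * ((b * k : ℕ) : ℝ) := by positivity
    calc _ ≤ 2 * (m * ((b * k : ℕ) : ℝ)) := by linarith
      _ ≤ 2 * (m * ((κ + 1) * K₀ * (1 / ε ^ 2 *
        (Real.logb 2 (Real.logb 2 ((n : ℝ) * m * M)) + Real.logb 2 (2 / ε))))) := by linarith
      _ = _ := by ring
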